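/- **Setting.** Let $\mathfrak F$ be the Hilbert space of a lattice system on a set $V$ of sites, where each site carries finitely many fermionic modes (described by the fermionic Fock space) and a finite-dimensional spin space (lattice fermion systems and quantum spin systems are special cases). For finite $X\subset V$ let $\mathfrak A_X$ be the algebra of observables supported in $X$, generated by the creation, annihilation and spin operators at the sites of $X$; the norm closure of $\bigcup_X\mathfrak A_X$ is the algebra of quasilocal observables. A pair $A\in\mathfrak A_X$, $B\in\mathfrak A_Y$ is called *fermionic* if $AB+BA=0$ whenever $X\cap Y=\emptyset$, and *bosonic* if $AB-BA=0$ whenever $X\cap Y=\emptyset$. Consider a sequence of finite connected lattices $\Lambda$ (finite site sets $\Lambda_s\subset V$ with bonds, graph distance $\mathrm{dist}_\Lambda$) and Hamiltonians $H_\Lambda=\sum_{X\subset\Lambda_s}h_X$, where $h_X=h_X^*\in\mathfrak A_X$ (which may depend on $\Lambda$) commutes with every observable of $\Lambda$ with support disjoint from $X$. The interaction is *power-law decaying* with exponent $\eta>0$ if, for all $\Lambda$ and all $x,y\in\Lambda_s$, with constants independent of $\Lambda$, either * $\sum_{X\ni x,y}\|h_X\|\le\lambda_0[1+\mathrm{dist}_\Lambda(x,y)]^{-\eta}$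 and $\sum_{z\in\Lambda_s}[1+\mathrm{dist}_\Lambda(x,z)]^{-\eta}[1+\mathrm{dist}_\Lambda(z,y)]^{-\eta}\le p_0[1+\mathrm{dist}_\Lambda(x,y)]^{-\eta}$, with $\lambda_0,p_0>0$; or * $\sum_{X\ni x}\|h_X\|\,|X|\,[1+\mathrm{diam}_\Lambda(X)]^{\eta}\le s_1$, with $s_1>0$. It is *exponentially decaying* with rate $\mu>0$ if, in the same sense, either * $\sum_{y\in\Lambda_s}[1+\mathrm{dist}_\Lambda(x,y)]^{-\eta}\le K$ and $\sum_{X\ni x,y}\|h_X\|\le\lambda_0e^{-(\mu+\varepsilon)\mathrm{dist}_\Lambda(x,y)}$, with $\lambda_0,\varepsilon,\eta>0$; or * $\sum_{X\ni x}\|h_X\|\,|X|\,e^{\mu\,\mathrm{diam}_\Lambda(X)}\le s_1$, with $s_1>0$. There is a *uniform gap* $\Delta E>0$ if for each $\Lambda$ there is a nonempty set of eigenvalues of $H_\Lambda$ (the ground state sector, of total multiplicity $q=q_\Lambda$) at the bottom of the spectrum whose width tends to $0$ along the sequence, and every other eigenvalue exceeds every eigenvalue of the sector by more than $\Delta E$.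 With $P_{0,\Lambda}$ the spectral projection of $H_\Lambda$ on the sector, put $\langle A\rangle_{0,\Lambda}=\frac1q\mathrm{Tr}(AP_{0,\Lambda})$, the trace being over the Hilbert space of $\Lambda$. Suppose that the $\Lambda$'s exhaust $V$, $|\Lambda_s|\to\infty$, and that for all $x,y$ eventually $\mathrm{dist}_\Lambda(x,y)=\mathrm{dist}(x,y)$, the distance of a graph on $V$. An *infinite-volume ground-state expectation* $\langle\cdot\rangle_0$ is a linear functional, on some linear space of quasilocal observables, which is the pointwise limit of $\langle\cdot\rangle_{0,\Lambda}$ along a subsequence of the lattices. **Corollary.** There are positive functions $v_\eta$ of $\eta$ and of the constants $(\lambda_0,p_0)$ or $s_1$ of the power-law condition, and $v_\mu$ of $\mu$ and of the constants $(\lambda_0,\varepsilon,\eta,K)$ or $s_1$ of the exponential condition, nondecreasing in $\eta$, respectively in $\mu$, when the other constants are fixed, such that the following holds. 1. (They bound the velocity of information propagation.) Put $g(r)=(1+r)^{-\eta}$, $v=v_\eta$ for power-law decaying and $g(r)=e^{-\mu r}$, $v=v_\mu$ for exponentially decaying interactions, and $A(t)=e^{itH_\Lambda}Ae^{-itH_\Lambda}$.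 There is a constant $C$ depending only on $\eta$ (resp. $\mu$) and the constants of the condition such that for all $\Lambda$, all $X,Y\subset\Lambda_s$ with $\mathrm{dist}_\Lambda(X,Y)>0$, all $A\in\mathfrak A_X$, $B\in\mathfrak A_Y$ and $t\in\mathbb R$, $$\|A(t)B\mp BA(t)\|\le C\|A\|\|B\||X||Y|\,g(\mathrm{dist}_\Lambda(X,Y))\,(e^{v|t|}-1),$$ with the sign $-$ if the pair $A,B$ is bosonic and $+$ if it is fermionic. 2. Let there be a uniform gap $\Delta E>0$. There is a constant $C$ depending only on $\Delta E$, on $\eta$ (resp. $\mu$) and on the constants of the condition such that for every infinite-volume ground-state expectation $\langle\cdot\rangle_0$, all finite $X,Y\subset V$ and every fermionic pair $A_X\in\mathfrak A_X$, $B_Y\in\mathfrak A_Y$ for which $\langle A_XB_Y\rangle_0$ is defined, $$|\langle A_XB_Y\rangle_0|\le C\|A_X\|\|B_Y\||X||Y|\times\begin{cases}[1+\mathrm{dist}(X,Y)]^{-\tilde\eta}&\text{for power-law decaying }h_X,\\ e^{-\tilde\mu\,\mathrm{dist}(X,Y)}&\text{for exponentially decaying }h_X,\end{cases}$$ where $\tilde\eta=\dfrac{\eta}{1+2v_\eta/\Delta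 E}$ and $\tilde\mu=\dfrac{\mu}{1+2v_\mu/\Delta E}$. -/

import Mathlib

open Filter Topology
open scoped InnerProductSpace

universe u

noncomputable section

namespace LatticeQuantum

/-! ### The Hilbert space

A site `x` carries `k x` fermionic modes and a "spin" space of dimension `d x + 1`.  A lattice
fermion system is the case `d = 0`, a quantum spin system the case `k = 0`.  All finite volumes are
realized inside one Hilbert space `Fock k d`, whose orthonormal basis is indexed by the
configurations that differ from the reference configuration (no fermion, spin label `0`) at
finitely many sites only. -/

/-- The fermionic modes. The linear order only serves to fix the signs in the Fock space. -/
abbrev Mode {V : Type u} (k : V → ℕ) : Type u := Σₗ x : V, Fin (k x)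

/-- The site of a mode. -/
def Mode.site {V : Type u} {k : V → ℕ} (m : Mode k) : V := (ofLex m).1

/-- A configuration: the set of occupied modes, and the spin label of each site. -/
abbrev Config {V : Type u} (k d : V → ℕ) : Type u :=
  Finset (Mode k) × (Π₀ x : V, Fin (d x + 1))

/-- `ℓ²` over the configurations. -/
abbrev Fock {V : Type u} (k d : V → ℕ) : Type u := lp (fun _ : Config k d => ℂ) 2

/-- Bounded operators. -/
abbrev Op {V : Type u} (k d : V → ℕ) : Type u := Fock k d →L[ℂ] Fock k d

section Shift

variable {ι : Type u}

theorem shift_sum_le (p : ι → Prop) [DecidablePred p] (s : ι → ℂ) (g : ι → ι)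
    (hg : Set.InjOn g {c | p c}) (hs : ∀ c, ‖s c‖ ≤ 1) (f : lp (fun _ : ι => ℂ) 2)
    (T : Finset ι) :
    ∑ c ∈ T, ‖(if p c then s c * f (g c) else 0 : ℂ)‖ ^ (2 : ENNReal).toReal
      ≤ ‖f‖ ^ (2 : ENNReal).toReal := by
  classical
  have h2 : 0 < (2 : ENNReal).toReal := by norm_num
  calc
    ∑ c ∈ T, ‖(if p c then s c * f (g c) else 0 : ℂ)‖ ^ (2 : ENNReal).toReal
        ≤ ∑ c ∈ T, if p c then ‖f (g c)‖ ^ (2 : ENNReal).toReal else 0 := by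
          refine Finset.sum_le_sum fun c _ => ?_
          split_ifs
          · refine Real.rpow_le_rpow (norm_nonneg _) ?_ h2.le
            rw [norm_mul]
            exact mul_le_of_le_one_left (norm_nonneg _) (hs c)
          · rw [norm_zero, Real.zero_rpow h2.ne']
    _ = ∑ c ∈ T.filter p, ‖f (g c)‖ ^ (2 : ENNReal).toReal := by rw [Finset.sum_filter]
    _ = ∑ c ∈ (T.filter p).image g, ‖f c‖ ^ (2 : ENNReal).toReal := by
          rw [Finset.sum_image]
          intro a ha b hb hab
          exact hg (Finset.mem_filter.1 ha).2 (Finset.mem_filter.1 hb).2 hab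
    _ ≤ ‖f‖ ^ (2 : ENNReal).toReal := lp.sum_rpow_le_norm_rpow h2 f _

/-- The bounded operator `(T f)(c) = s(c) f(g(c))` if `p(c)` holds, and `(T f)(c) = 0` otherwise,
where `g` is injective on `p` and `|s| ≤ 1`. -/
def shiftOp (p : ι → Prop) [DecidablePred p] (s : ι → ℂ) (g : ι → ι)
    (hg : Set.InjOn g {c | p c}) (hs : ∀ c, ‖s c‖ ≤ 1) :
    lp (fun _ : ι => ℂ) 2 →L[ℂ] lp (fun _ : ι => ℂ) 2 :=
  LinearMap.mkContinuous
    { toFun := fun f => ⟨fun c => if p c then s c * f (g c) else 0,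
        memℓp_gen' (C := ‖f‖ ^ (2 : ENNReal).toReal) (shift_sum_le p s g hg hs f)⟩
      map_add' := fun f f' => by
        ext c
        change (if p c then s c * (f (g c) + f' (g c)) else 0 : ℂ) =
          (if p c then s c * f (g c) else 0) + (if p c then s c * f' (g c) else 0)
        by_cases h : p c <;> simp [h, mul_add]
      map_smul' := fun a f => by
        ext c
        by_cases h : p c <;> simp [h, mul_left_comm] }
    1 fun f => by
      rw [one_mul]
      exact lp.norm_le_of_forall_sum_le (by norm_num) (norm_nonneg _)
        (shift_sum_le p s g hg hs f)

end Shift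

section Local

variable {V : Type u} [LinearOrder V] (k d : V → ℕ)

/-- The annihilation operator of the mode `m`: it maps the basis vector with occupied set
`insert m S`, `m ∉ S`, to `(-1) ^ #{j ∈ S | j < m}` times the basis vector with occupied set `S`,
and kills the basis vectors in which `m` is empty. -/
def annihilation (m : Mode k) : Op k d :=
  shiftOp (fun c : Config k d => m ∉ c.1)
    (fun c => (-1 : ℂ) ^ (c.1.filter fun j => j < m).card)
    (fun c => (insert m c.1, c.2))
    (by
      rintro ⟨S, σ⟩ hS ⟨S', σ'⟩ hS' h
      simp only [Set.mem_ofPred_eq, Prod.mk.injEq] at hS hS' h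
      refine Prod.ext ?_ h.2
      have := congrArg (fun T => T.erase m) h.1
      simpa [Finset.erase_insert hS, Finset.erase_insert hS'] using this)
    (fun c => by simp)

/-- The matrix unit `|i⟩⟨j|` of the spin space at the site `x`. -/
def spinUnit (x : V) (i j : Fin (d x + 1)) : Op k d :=
  shiftOp (fun c : Config k d => c.2 x = i) (fun _ => 1) (fun c => (c.1, c.2.update x j))
    (by
      rintro ⟨S, σ⟩ hS ⟨S', σ'⟩ hS' h
      simp only [Set.mem_ofPred_eq, Prod.mk.injEq] at hS hS' h
      refine Prod.ext h.1 (DFinsupp.ext fun y => ?_)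
      by_cases hy : y = x
      · subst hy
        exact hS.trans hS'.symm
      · have := DFunLike.congr_fun h.2 y
        simpa [Function.update_of_ne hy] using this)
    (fun c => by simp)

/-- The algebra of the observables supported in the finite set `X` of sites: generated by the
annihilation and creation operators and by the spin operators at the sites of `X`. -/
def localAlgebra (X : Finset V) : StarSubalgebra ℂ (Op k d) :=
  StarAlgebra.adjoin ℂ
    ({T | ∃ m : Mode k, m.site ∈ X ∧ T = annihilation k d m} ∪
      {T | ∃ x ∈ X, ∃ i j, T = spinUnit k d x i j})

/-- The quasilocal observables: the norm closure of the union of the local algebras. -/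
def quasilocalAlgebra : StarSubalgebra ℂ (Op k d) :=
  (⨆ X : Finset V, localAlgebra k d X).topologicalClosure

/-- The configurations that agree with the reference configuration outside `Λ`. -/
def configOn (Λ : Finset V) : Set (Config k d) :=
  {c | (∀ m ∈ c.1, m.site ∈ Λ) ∧ ∀ x, x ∉ Λ → c.2 x = 0}

/-- The Hilbert space of the finite volume `Λ`, i.e. the Fock space over the modes in `Λ` tensored
with the spin spaces at the sites of `Λ`. -/
def fockOn (Λ : Finset V) : Submodule ℂ (Fock k d) where
  carrier := {ψ | ∀ c, c ∉ configOn k d Λ → ψ c = 0}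
  zero_mem' := fun _ _ => rfl
  add_mem' := fun {a b} ha hb c hc => by simp [ha c hc, hb c hc]
  smul_mem' := fun r a ha c hc => by simp [ha c hc]

theorem configOn_finite (Λ : Finset V) : (configOn k d Λ).Finite := by
  classical
  let F : Finset (Mode k) := (Λ.sigma fun x => (Finset.univ : Finset (Fin (k x)))).map
    (toLex : (Σ x : V, Fin (k x)) ≃ Mode k).toEmbedding
  let φ : Config k d → Finset (Mode k) × (∀ x : Λ, Fin (d x + 1)) :=
    fun c => (c.1, fun x => c.2 x)
  refine Set.Finite.of_finite_image (f := φ)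
    (Set.Finite.subset ((F.powerset.finite_toSet).prod (Set.finite_univ)) ?_) ?_
  · rintro _ ⟨c, hc, rfl⟩
    refine ⟨?_, Set.mem_univ _⟩
    simp only [φ, Finset.coe_powerset, Set.mem_preimage, Set.mem_powerset_iff]
    intro m hm
    have := hc.1 m hm
    refine Finset.mem_coe.2 (Finset.mem_map.2 ⟨ofLex m, ?_, rfl⟩)
    exact Finset.mem_sigma.2 ⟨this, Finset.mem_univ _⟩
  · rintro ⟨S, σ⟩ hc ⟨S', σ'⟩ hc' h
    simp only [φ, Prod.mk.injEq] at h
    refine Prod.ext h.1 (DFinsupp.ext fun x => ?_)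
    by_cases hx : x ∈ Λ
    · exact congrFun h.2 ⟨x, hx⟩
    · exact (hc.2 x hx).trans (hc'.2 x hx).symm

instance fockOn_finiteDimensional (Λ : Finset V) : FiniteDimensional ℂ (fockOn k d Λ) := by
  have : Finite (configOn k d Λ) := configOn_finite k d Λ
  let L : fockOn k d Λ →ₗ[ℂ] (configOn k d Λ → ℂ) :=
    { toFun := fun ψ c => (ψ : Fock k d) c
      map_add' := fun a b => by ext c; simp
      map_smul' := fun r a => by ext c; simp }
  refine FiniteDimensional.of_injective L fun a b h => ?_
  apply Subtype.ext
  ext c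
  by_cases hc : c ∈ configOn k d Λ
  · exact congrFun h ⟨c, hc⟩
  · rw [a.2 c hc, b.2 c hc]

variable {k d}

/-- The compression of an operator to the finite-volume Hilbert space. For an observable supported
in `Λ`, which leaves `fockOn k d Λ` invariant, it is the restriction. -/
def onVolume (Λ : Finset V) (A : Op k d) : fockOn k d Λ →L[ℂ] fockOn k d Λ :=
  (fockOn k d Λ).orthogonalProjectionOnto ∘L A ∘L (fockOn k d Λ).subtypeL

/-- Anticommutation as soon as the supports are disjoint. -/
def IsFermionicPair (X Y : Finset V) (A B : Op k d) : Prop :=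
  Disjoint X Y → A * B + B * A = 0

/-- Commutation as soon as the supports are disjoint. -/
def IsBosonicPair (X Y : Finset V) (A B : Op k d) : Prop :=
  Disjoint X Y → A * B - B * A = 0

end Local

/-- The distance of two finite sets with respect to the graph distance. -/
def setDist {V : Type u} (G : SimpleGraph V) (X Y : Finset V) : ℕ :=
  sInf {r | ∃ x ∈ X, ∃ y ∈ Y, r = G.dist x y}

/-- The diameter of a finite set with respect to the graph distance. -/
def setDiam {V : Type u} (G : SimpleGraph V) (X : Finset V) : ℕ :=
  X.sup fun x => X.sup fun y => G.dist x y

/-- A sequence of finite connected lattices (site set `sites n`, bonds = edges of `graph n`) with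
local Hamiltonians `h n X`, `X ⊆ sites n`. As usual each `h n X` is a self-adjoint observable
supported in `X` that commutes with all observables of the lattice whose support is disjoint from
`X` (automatic for spins; for fermions, it is even). -/
structure LatticeSystem {V : Type u} [LinearOrder V] (k d : V → ℕ) where
  sites : ℕ → Finset V
  graph : ℕ → SimpleGraph V
  h : ℕ → Finset V → Op k d
  nonempty : ∀ n, (sites n).Nonempty
  adj_mem : ∀ n x y, (graph n).Adj x y → x ∈ sites n ∧ y ∈ sites n
  connected : ∀ n, ∀ x ∈ sites n, ∀ y ∈ sites n, (graph n).Reachable x y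
  h_mem : ∀ n, ∀ X ⊆ sites n, h n X ∈ localAlgebra k d X
  h_selfAdjoint : ∀ n, ∀ X ⊆ sites n, IsSelfAdjoint (h n X)
  h_bosonic : ∀ n, ∀ X ⊆ sites n, ∀ Y ⊆ sites n, ∀ B ∈ localAlgebra k d Y,
    IsBosonicPair X Y (h n X) B

/-- The constants in the two alternative conditions on power-law decaying interactions. -/
inductive PowerConstants where
  | pairwise (lam p : ℝ)
  | summed (s : ℝ)

/-- The constants in the two alternative conditions on exponentially decaying interactions. -/
inductive ExpConstants where
  | pairwise (lam ε η K : ℝ)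
  | summed (s : ℝ)

namespace LatticeSystem

variable {V : Type u} [LinearOrder V] {k d : V → ℕ} (S : LatticeSystem k d)

/-- The Hamiltonian `H_Λ = ∑_{X ⊆ Λ} h_X`. -/
def hamiltonian (n : ℕ) : Op k d := ∑ X ∈ (S.sites n).powerset, S.h n X

/-- `A(t) = exp(i t H) A exp(-i t H)`. -/
def evolve (n : ℕ) (t : ℝ) (A : Op k d) : Op k d :=
  NormedSpace.exp ((Complex.I * (t : ℂ)) • S.hamiltonian n) * A *
    NormedSpace.exp ((-(Complex.I * (t : ℂ))) • S.hamiltonian n)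

/-- `E` is an eigenvalue of the finite-volume Hamiltonian. -/
def IsEnergy (n : ℕ) (E : ℝ) : Prop :=
  Module.End.HasEigenvalue
    (onVolume (S.sites n) (S.hamiltonian n) : Module.End ℂ (fockOn k d (S.sites n))) (E : ℂ)

/-- The span of the eigenvectors whose eigenvalues belong to `sector n`. -/
def groundSpace (sector : ℕ → Finset ℝ) (n : ℕ) : Submodule ℂ (fockOn k d (S.sites n)) :=
  ⨆ E ∈ sector n, Module.End.eigenspace
    (onVolume (S.sites n) (S.hamiltonian n) : Module.End ℂ (fockOn k d (S.sites n))) (E : ℂ)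

/-- The finite-volume ground-state expectation `q⁻¹ Tr (A P₀)`, where `P₀` is the projection onto
the ground state sector and `q` the dimension of that sector. -/
def expectation (sector : ℕ → Finset ℝ) (n : ℕ) (A : Op k d) : ℂ :=
  (Module.finrank ℂ (S.groundSpace sector n) : ℂ)⁻¹ *
    LinearMap.trace ℂ (fockOn k d (S.sites n))
      (onVolume (S.sites n) A ∘L (S.groundSpace sector n).starProjection).toLinearMap

/-- Uniform gap: `sector n` is a nonempty set of eigenvalues at the bottom of the spectrum of the
`n`-th Hamiltonian, its width tends to zero, and the rest of the spectrum lies above it at a distance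
larger than `ΔE`. The number of eigenvalues in the sector may depend on `n`. -/
structure HasUniformGap (sector : ℕ → Finset ℝ) (ΔE : ℝ) : Prop where
  nonempty : ∀ n, (sector n).Nonempty
  isEnergy : ∀ n, ∀ E ∈ sector n, S.IsEnergy n E
  width : Tendsto (fun n => Metric.diam (sector n : Set ℝ)) atTop (𝓝 0)
  gap : ∀ n, ∀ E ∈ sector n, ∀ E', S.IsEnergy n E' → E' ∉ sector n → ΔE < E' - E

/-- Power-law decaying interactions with exponent `η`, in either of the two forms. -/
def PowerLaw (η : ℝ) : PowerConstants → Prop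
  | .pairwise lam p => 0 < lam ∧ 0 < p ∧
      (∀ n, ∀ x ∈ S.sites n, ∀ y ∈ S.sites n,
        ∑ X ∈ (S.sites n).powerset with x ∈ X ∧ y ∈ X, ‖S.h n X‖
          ≤ lam / (1 + ((S.graph n).dist x y : ℝ)) ^ η) ∧
      (∀ n, ∀ x ∈ S.sites n, ∀ y ∈ S.sites n,
        ∑ z ∈ S.sites n, 1 / (1 + ((S.graph n).dist x z : ℝ)) ^ η *
            (1 / (1 + ((S.graph n).dist z y : ℝ)) ^ η)
          ≤ p / (1 + ((S.graph n).dist x y : ℝ)) ^ η)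
  | .summed s => 0 < s ∧
      ∀ n, ∀ x ∈ S.sites n,
        ∑ X ∈ (S.sites n).powerset with x ∈ X,
          ‖S.h n X‖ * (X.card : ℝ) * (1 + (setDiam (S.graph n) X : ℝ)) ^ η ≤ s

/-- Exponentially decaying interactions with rate `μ`, in either of the two forms. -/
def ExpDecay (μ : ℝ) : ExpConstants → Prop
  | .pairwise lam ε η K => 0 < lam ∧ 0 < ε ∧ 0 < η ∧
      (∀ n, ∀ x ∈ S.sites n,
        ∑ y ∈ S.sites n, 1 / (1 + ((S.graph n).dist x y : ℝ)) ^ η ≤ K) ∧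
      (∀ n, ∀ x ∈ S.sites n, ∀ y ∈ S.sites n,
        ∑ X ∈ (S.sites n).powerset with x ∈ X ∧ y ∈ X, ‖S.h n X‖
          ≤ lam * Real.exp (-(μ + ε) * ((S.graph n).dist x y : ℝ)))
  | .summed s => 0 < s ∧
      ∀ n, ∀ x ∈ S.sites n,
        ∑ X ∈ (S.sites n).powerset with x ∈ X,
          ‖S.h n X‖ * (X.card : ℝ) * Real.exp (μ * (setDiam (S.graph n) X : ℝ)) ≤ s

/-- `v` bounds the velocity of the information propagation: outside the "light cone" described by
the decay function `f` and the velocity `v`, a time-evolved observable still almost commutes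
(bosonic pairs) or anticommutes (fermionic pairs) with a distant one, uniformly in the volume. -/
def IsGroupVelocityBound (f : ℝ → ℝ) (C v : ℝ) : Prop :=
  ∀ n, ∀ X ⊆ S.sites n, ∀ Y ⊆ S.sites n, 0 < setDist (S.graph n) X Y →
    ∀ A ∈ localAlgebra k d X, ∀ B ∈ localAlgebra k d Y, ∀ t : ℝ,
      (IsBosonicPair X Y A B →
        ‖S.evolve n t A * B - B * S.evolve n t A‖ ≤ C * ‖A‖ * ‖B‖ * X.card * Y.card *
          f (setDist (S.graph n) X Y) * (Real.exp (v * |t|) - 1)) ∧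
      (IsFermionicPair X Y A B →
        ‖S.evolve n t A * B + B * S.evolve n t A‖ ≤ C * ‖A‖ * ‖B‖ * X.card * Y.card *
          f (setDist (S.graph n) X Y) * (Real.exp (v * |t|) - 1))

/-- The finite lattices exhaust the infinite lattice `Γ`, and their graph distances converge to that
of `Γ` (open boundary conditions, periodic boundary conditions, ...). -/
structure Exhausts (Γ : SimpleGraph V) : Prop where
  card_tendsto : Tendsto (fun n => (S.sites n).card) atTop atTop
  eventually_mem : ∀ x, ∀ᶠ n in atTop, x ∈ S.sites n
  eventually_dist : ∀ x y, ∀ᶠ n in atTop, (S.graph n).dist x y = Γ.dist x y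

/-- `ω` is an infinite-volume ground-state expectation: a linear functional on a set `Q` of
quasilocal observables which is the limit, along a subsequence of the lattices, of the
finite-volume ground-state expectations. -/
def IsGroundStateExpectation (sector : ℕ → Finset ℝ) (Q : Submodule ℂ (Op k d))
    (ω : Q →ₗ[ℂ] ℂ) : Prop :=
  (∀ A ∈ Q, A ∈ quasilocalAlgebra k d) ∧
    ∃ φ : ℕ → ℕ, StrictMono φ ∧
      ∀ A : Q, Tendsto (fun j => S.expectation sector (φ j) A) atTop (𝓝 (ω A))

/-- The correlation of every fermionic pair `A ∈ 𝔄_X`, `B ∈ 𝔄_Y` in the state `ω` is at most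
`C ‖A‖ ‖B‖ |X| |Y| f(dist(X, Y))`. -/
def FermionicDecay {V : Type u} [LinearOrder V] {k d : V → ℕ} (Γ : SimpleGraph V)
    (Q : Submodule ℂ (Op k d)) (ω : Q →ₗ[ℂ] ℂ) (f : ℝ → ℝ) (C : ℝ) : Prop :=
  ∀ X Y : Finset V, ∀ A ∈ localAlgebra k d X, ∀ B ∈ localAlgebra k d Y,
    IsFermionicPair X Y A B → ∀ hAB : A * B ∈ Q,
      ‖ω ⟨A * B, hAB⟩‖ ≤ C * ‖A‖ * ‖B‖ * X.card * Y.card * f (setDist Γ X Y)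

end LatticeSystem

end LatticeQuantum

end

/-! The proof combines a Lieb–Robinson bound with a smoothed spectral projection.

Propagation. Let `φ x y = g (dist x y)`. Each decay condition says that convolving `φ` with the
interaction reproduces `φ` up to a factor (`IsPropagationKernel`), so `φ * exp (v * t)` is a
supersolution of the integral inequality for the commutators of evolved interaction terms. Iterating
this inequality leaves a remainder `(c * t) ^ n / n!`; its constant `c` depends on the volume, but
the remainder vanishes as `n` grows. The terms of the Hamiltonian commute with distant observables,
so only commutators occur in the iteration, even when the quantity to be estimated is an
anticommutator; the sign enters through the value at time zero only (`norm_heisenberg_comm_le`,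
`lieb_robinson`).

Clustering. If `AB = -BA`, then in an eigenbasis `2 Tr (P₀ A B)` is the sum over `i` in the sector
and all `m` of `A_im B_mi - B_im A_mi`. This expression is antisymmetric in `i` and `m`, so the
terms with both indices in the sector cancel; hence no product of expectations has to be subtracted
and the degeneracy is arbitrary. For the remaining `m` the energy difference is at least `ΔE`, and
the coefficient `1` may be replaced by a Gaussian-smoothed sign of this difference with error `exp
(-ΔE ^ 2 / (4 * α))`. The smoothed sign is a sine transform, so the filtered sum is the integral of
the odd-in-time part of the anticommutator of `A(t)` and `B` against `exp (-α * t ^ 2) / t`. The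
Lieb–Robinson bound controls it for times up to `T`, the Gaussian beyond
(`norm_sum_inner_mul_le_of_gap`).

Optimization. With `g = exp (-G)`, the choices `α = ΔE / (2 * T)` and `T = G / (v + ΔE / 2)` make
the three exponents `G - v * T`, `α * T ^ 2` and `ΔE ^ 2 / (4 * α)` all equal to `G / (1 + 2 * v /
ΔE)`, which is the asserted rate. The nonzero width of the sector costs an error that disappears in
the infinite-volume limit (`PropagatesAs.fermionicDecay`). -/

noncomputable section

namespace LatticeQuantum

/-! ### Unitary dynamics in a C⋆-algebra -/

section Dynamics

variable {𝒜 : Type*} [CStarAlgebra 𝒜]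

/-- The unitary group `exp (i t H)`. -/
def propagator (H : 𝒜) (t : ℝ) : 𝒜 := NormedSpace.exp ((Complex.I * (t : ℂ)) • H)

/-- The Heisenberg dynamics `exp (i t H) a exp (-i t H)`. -/
def heisenberg (H : 𝒜) (t : ℝ) (a : 𝒜) : 𝒜 := propagator H t * a * propagator H (-t)

theorem propagator_eq (H : 𝒜) (t : ℝ) :
    propagator H t = NormedSpace.exp (t • (Complex.I • H)) := by
  rw [propagator, mul_comm, mul_smul, Complex.coe_smul]

theorem propagator_neg_left (H : 𝒜) (t : ℝ) : propagator (-H) t = propagator H (-t) := by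
  simp [propagator]

theorem propagator_zero (H : 𝒜) : propagator H 0 = 1 := by
  simp [propagator]

theorem propagator_mul_neg (H : 𝒜) (t : ℝ) : propagator H t * propagator H (-t) = 1 := by
  let : NormedAlgebra ℚ 𝒜 := NormedAlgebra.restrictScalars ℚ ℂ 𝒜
  rw [propagator, propagator, ← NormedSpace.exp_add_of_commute]
  · simp
  · exact ((Commute.refl H).smul_left _).smul_right _

theorem propagator_neg_mul (H : 𝒜) (t : ℝ) : propagator H (-t) * propagator H t = 1 := by
  simpa using propagator_mul_neg H (-t)

theorem propagator_mem_unitary {H : 𝒜} (hH : IsSelfAdjoint H) (t : ℝ) :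
    propagator H t ∈ unitary 𝒜 := by
  let : NormedAlgebra ℚ 𝒜 := NormedAlgebra.restrictScalars ℚ ℂ 𝒜
  refine NormedSpace.exp_mem_unitary_of_mem_skewAdjoint ?_
  rw [skewAdjoint.mem_iff, star_smul, hH.star_eq]
  simp

theorem commute_propagator {H a : 𝒜} (h : Commute a H) (t : ℝ) : Commute a (propagator H t) := by
  let : NormedAlgebra ℚ 𝒜 := NormedAlgebra.restrictScalars ℚ ℂ 𝒜
  exact (h.smul_right _).exp_right

theorem hasDerivAt_propagator (H : 𝒜) (t : ℝ) :
    HasDerivAt (propagator H) (propagator H t * (Complex.I • H)) t := by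
  have := hasDerivAt_exp_smul_const (𝕂 := ℝ) (Complex.I • H) t
  rw [← propagator_eq] at this
  exact this.congr_of_eventuallyEq (Eventually.of_forall fun s => propagator_eq H s)

theorem hasDerivAt_propagator_neg (H : 𝒜) (t : ℝ) :
    HasDerivAt (fun s => propagator H (-s)) (-(Complex.I • H) * propagator H (-t)) t := by
  have h := hasDerivAt_propagator (-H) t
  simp only [propagator_neg_left, smul_neg] at h
  have hc : Commute (-(Complex.I • H)) (propagator H (-t)) :=
    commute_propagator ((Commute.refl H).smul_left _).neg_left _
  rw [hc.eq]
  have e : propagator (-H) = fun s => propagator H (-s) := funext fun s => propagator_neg_left H s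
  rwa [e] at h

theorem heisenberg_neg_left (H : 𝒜) (t : ℝ) (a : 𝒜) :
    heisenberg (-H) t a = heisenberg H (-t) a := by
  simp [heisenberg, propagator_neg_left]

theorem heisenberg_sum {ι : Type*} (H : 𝒜) (t : ℝ) (s : Finset ι) (f : ι → 𝒜) :
    heisenberg H t (∑ i ∈ s, f i) = ∑ i ∈ s, heisenberg H t (f i) := by
  simp [heisenberg, Finset.mul_sum, Finset.sum_mul]

theorem heisenberg_zero (H : 𝒜) (a : 𝒜) : heisenberg H 0 a = a := by
  simp [heisenberg, propagator_zero]

theorem norm_heisenberg {H : 𝒜} (hH : IsSelfAdjoint H) (t : ℝ) (a : 𝒜) :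
    ‖heisenberg H t a‖ = ‖a‖ := by
  rw [heisenberg, CStarRing.norm_mul_mem_unitary _ (propagator_mem_unitary hH _),
    CStarRing.norm_mem_unitary_mul _ (propagator_mem_unitary hH _)]

theorem norm_mul_add_smul_mul_le (a b : 𝒜) {s : ℂ} (hs : ‖s‖ ≤ 1) :
    ‖a * b + s • (b * a)‖ ≤ 2 * ‖a‖ * ‖b‖ := by
  have h1 := norm_mul_le a b
  have h2 : ‖s • (b * a)‖ ≤ ‖b‖ * ‖a‖ := by
    rw [norm_smul]
    calc ‖s‖ * ‖b * a‖ ≤ 1 * (‖b‖ * ‖a‖) :=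
          mul_le_mul hs (norm_mul_le b a) (norm_nonneg _) zero_le_one
      _ = _ := one_mul _
  linarith [norm_add_le (a * b) (s • (b * a)), mul_comm ‖a‖ ‖b‖]

/-- A perturbative bound on (anti)commutators of time-evolved observables: only the part of the
generator that does not commute with `a` matters. -/
theorem norm_heisenberg_comm_le {H H' a b : 𝒜} (hH : IsSelfAdjoint H) (hH' : IsSelfAdjoint H')
    (ha : Commute a H') {β β' : ℝ → ℝ} (hβ0 : β 0 = 0) (hβ : ∀ τ, HasDerivAt β (β' τ) τ)
    {t : ℝ} (ht : 0 ≤ t)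
    (hb : ∀ τ, 0 ≤ τ →
      ‖heisenberg H τ (H - H') * b - b * heisenberg H τ (H - H')‖ ≤ β' τ)
    {s : ℂ} (hs : ‖s‖ ≤ 1) :
    ‖heisenberg H t a * b + s • (b * heisenberg H t a)‖ ≤
      ‖a * b + s • (b * a)‖ + 2 * ‖a‖ * β t := by
  -- Interaction picture: `b` is evolved backwards with `H` and forwards with `H'`, so the
  -- derivative contains only `H - H'`. Moving `b` instead of `a` makes this derivative a commutator
  -- whatever the sign `s`.
  let Φ : ℝ → 𝒜 := fun τ => heisenberg H' τ (heisenberg H (-τ) b)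
  let K : 𝒜 := Complex.I • (H - H')
  let Φ' : ℝ → 𝒜 := fun τ => heisenberg H' τ
    (heisenberg H (-τ) b * K - K * heisenberg H (-τ) b)
  have hΦ : ∀ τ, HasDerivAt Φ (Φ' τ) τ := by
    intro τ
    have h1 := ((hasDerivAt_propagator H' τ).mul ((((hasDerivAt_propagator_neg H τ).mul_const b).mul
      (hasDerivAt_propagator H τ)))).mul (hasDerivAt_propagator_neg H' τ)
    have h2 : HasDerivAt Φ _ τ := h1.congr_of_eventuallyEq
      (Eventually.of_forall fun s => by simp [Φ, heisenberg])
    convert h2 using 1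
    simp only [Φ', K, heisenberg, neg_neg, smul_sub, Pi.mul_apply]
    generalize Complex.I • H = x
    generalize Complex.I • H' = y
    noncomm_ring
  have hn : ∀ τ, 0 ≤ τ → ‖Φ' τ‖ ≤ β' τ := by
    intro τ hτ
    refine le_trans (le_of_eq ?_) (hb τ hτ)
    simp only [Φ']
    rw [norm_heisenberg hH', ← norm_heisenberg hH τ]
    have e : heisenberg H τ (heisenberg H (-τ) b * K - K * heisenberg H (-τ) b) =
        Complex.I • (b * heisenberg H τ (H - H') - heisenberg H τ (H - H') * b) := by
      have h1 := propagator_mul_neg H τ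
      simp only [heisenberg, K, neg_neg, mul_sub, sub_mul, smul_sub, mul_smul_comm, smul_mul_assoc,
        ← mul_assoc, h1, one_mul]
      simp only [mul_assoc, h1, mul_one]
    rw [e, norm_smul, Complex.norm_I, one_mul, norm_sub_rev]
  have hmv : ‖Φ t - b‖ ≤ β t := by
    have := image_norm_le_of_norm_deriv_right_le_deriv_boundary (f := fun τ => Φ τ - b) (f' := Φ')
      (a := 0) (b := t) (B := β) (B' := β')
      (fun τ _ => ((hΦ τ).sub_const b).continuousAt.continuousWithinAt)
      (fun τ _ => ((hΦ τ).sub_const b).hasDerivWithinAt)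
      (by simp [Φ, heisenberg_zero, hβ0]) hβ (fun τ hτ => hn τ hτ.1)
    exact this ⟨ht, le_rfl⟩
  -- Since `a` is invariant under the dynamics of `H'`, the whole expression is a conjugate of the
  -- same expression at time zero with `b` replaced by `Φ t`, and conjugation preserves the norm.
  have e : heisenberg H t a * b + s • (b * heisenberg H t a) =
      heisenberg H t (heisenberg H' (-t) (a * Φ t + s • (Φ t * a))) := by
    have h1 := propagator_mul_neg H t
    have h3 := propagator_mul_neg H' t
    have h4 := propagator_neg_mul H' t
    have hca : propagator H' (-t) * a = a * propagator H' (-t) := (commute_propagator ha (-t)).symm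
    have hca' : a * propagator H' (-t) * propagator H' t = a := by
      rw [mul_assoc, h4, mul_one]
    simp only [Φ, heisenberg, neg_neg, mul_add, add_mul, mul_smul_comm, smul_mul_assoc]
    congr 1
    · calc propagator H t * a * propagator H (-t) * b
          = propagator H t * (a * (propagator H' (-t) * propagator H' t)) * propagator H (-t) * b *
            (propagator H t * (propagator H' (-t) * propagator H' t) * propagator H (-t)) := by
            simp [h4, h1]
        _ = _ := by
            rw [← mul_assoc a, ← hca]
            simp only [mul_assoc]
    · congr 1
      have hca2 : a * propagator H' t = propagator H' t * a := commute_propagator ha t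
      calc b * (propagator H t * a * propagator H (-t))
          = (propagator H t * (propagator H' (-t) * propagator H' t) * propagator H (-t)) * b *
            propagator H t * (propagator H' (-t) * propagator H' t * a) * propagator H (-t) := by
            simp [h4, h1, mul_assoc]
        _ = _ := by
            rw [mul_assoc (propagator H' (-t)) _ a, ← hca2]
            simp only [mul_assoc]
  rw [e, norm_heisenberg hH, norm_heisenberg hH']
  have e2 : a * Φ t + s • (Φ t * a) =
      (a * b + s • (b * a)) + (a * (Φ t - b) + s • ((Φ t - b) * a)) := by
    simp only [mul_sub, sub_mul, smul_sub]; abel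
  rw [e2]
  refine (norm_add_le _ _).trans (add_le_add_right ?_ _)
  refine (norm_mul_add_smul_mul_le _ _ hs).trans ?_
  gcongr

end Dynamics

/-! ### Lieb–Robinson bounds for abstract local interactions -/

/-- The kernel `φ` controls the propagation generated by an interaction whose terms have the norms
`w Z`, with velocity `v`. -/
structure IsPropagationKernel {V : Type u} [DecidableEq V] (Λ : Finset V) (w : Finset V → ℝ)
    (φ : V → V → ℝ) (v : ℝ) : Prop where
  nonneg : ∀ x y, 0 ≤ φ x y
  diag : ∀ x, φ x x = 1
  convolution : ∀ x ∈ Λ, ∀ y ∈ Λ,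
    2 * ∑ Z ∈ Λ.powerset with x ∈ Z, w Z * ∑ z ∈ Z, φ z y ≤ v * φ x y

namespace IsPropagationKernel

variable {V : Type u} [DecidableEq V] {Λ : Finset V} {w w' : Finset V → ℝ}
  {φ : V → V → ℝ} {v : ℝ}

theorem mono (h : IsPropagationKernel Λ w φ v) (hw : ∀ Z ⊆ Λ, w' Z ≤ w Z) :
    IsPropagationKernel Λ w' φ v := by
  refine ⟨h.nonneg, h.diag, fun x hx y hy => le_trans ?_ (h.convolution x hx y hy)⟩
  gcongr with Z hZ
  · exact Finset.sum_nonneg fun z _ => h.nonneg z y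
  · exact hw Z (Finset.mem_powerset.1 (Finset.mem_filter.1 hZ).1)

/-- Summing the kernel inequality over the points of `X` and `Y`. -/
theorem sum_le (h : IsPropagationKernel Λ w φ v) (hw : ∀ Z, 0 ≤ w Z) {X Y : Finset V}
    (hX : X ⊆ Λ) (hY : Y ⊆ Λ) :
    ∑ Z ∈ Λ.powerset with ¬ Disjoint Z X, 2 * w Z * ∑ z ∈ Z, ∑ y ∈ Y, φ z y ≤
      v * ∑ x ∈ X, ∑ y ∈ Y, φ x y := by
  have hS : ∀ Z, 0 ≤ 2 * w Z * ∑ z ∈ Z, ∑ y ∈ Y, φ z y := fun Z =>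
    mul_nonneg (mul_nonneg zero_le_two (hw Z))
      (Finset.sum_nonneg fun z _ => Finset.sum_nonneg fun y _ => h.nonneg z y)
  calc ∑ Z ∈ Λ.powerset with ¬ Disjoint Z X, 2 * w Z * ∑ z ∈ Z, ∑ y ∈ Y, φ z y
      ≤ ∑ Z ∈ Λ.powerset, ∑ x ∈ X, if x ∈ Z then 2 * w Z * ∑ z ∈ Z, ∑ y ∈ Y, φ z y else 0 := by
        rw [Finset.sum_filter]
        refine Finset.sum_le_sum fun Z _ => ?_
        have h0 : ∀ x ∈ X, 0 ≤ if x ∈ Z then 2 * w Z * ∑ z ∈ Z, ∑ y ∈ Y, φ z y else 0 := by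
          intro x _
          split_ifs
          · exact hS Z
          · exact le_rfl
        split_ifs with hd
        · exact Finset.sum_nonneg h0
        · obtain ⟨x, hxZ, hxX⟩ := Finset.not_disjoint_iff.1 hd
          refine le_trans (le_of_eq ?_) (Finset.single_le_sum h0 hxX)
          rw [if_pos hxZ]
    _ = ∑ x ∈ X, ∑ y ∈ Y, 2 * ∑ Z ∈ Λ.powerset with x ∈ Z, w Z * ∑ z ∈ Z, φ z y := by
        rw [Finset.sum_comm]
        refine Finset.sum_congr rfl fun x _ => ?_
        rw [← Finset.sum_filter, ← Finset.mul_sum, Finset.sum_comm, Finset.mul_sum]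
        refine Finset.sum_congr rfl fun Z _ => ?_
        rw [Finset.sum_comm, ← Finset.mul_sum, mul_assoc]
    _ ≤ ∑ x ∈ X, ∑ y ∈ Y, v * φ x y :=
        Finset.sum_le_sum fun x hx => Finset.sum_le_sum fun y hy =>
          h.convolution x (hX hx) y (hY hy)
    _ = v * ∑ x ∈ X, ∑ y ∈ Y, φ x y := by simp_rw [Finset.mul_sum]

end IsPropagationKernel

section LiebRobinson

variable {V : Type u} [DecidableEq V] {Λ : Finset V} {φ : V → V → ℝ} {v : ℝ}
  {𝒜 : Type*} [CStarAlgebra 𝒜] {h : Finset V → 𝒜}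

theorem norm_comm_heisenberg_sum_le (H : 𝒜) (τ : ℝ) (b : 𝒜) {ι : Type*} (s : Finset ι)
    (f : ι → 𝒜) :
    ‖heisenberg H τ (∑ i ∈ s, f i) * b - b * heisenberg H τ (∑ i ∈ s, f i)‖ ≤
      ∑ i ∈ s, ‖heisenberg H τ (f i) * b - b * heisenberg H τ (f i)‖ := by
  rw [heisenberg_sum, Finset.sum_mul, Finset.mul_sum, ← Finset.sum_sub_distrib]
  exact norm_sum_le _ _

theorem sum_powerset_sub_disjoint (h : Finset V → 𝒜) (X : Finset V) :
    ∑ Z ∈ Λ.powerset, h Z - ∑ Z ∈ Λ.powerset with Disjoint Z X, h Z =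
      ∑ Z ∈ Λ.powerset with ¬ Disjoint Z X, h Z := by
  rw [← Finset.sum_filter_add_sum_filter_not Λ.powerset (fun Z => Disjoint Z X) h, add_sub_cancel_left]

/-- The Duhamel step of the Lieb–Robinson iteration. -/
theorem norm_heisenberg_comm_le_of_local (hsa : ∀ Z ⊆ Λ, IsSelfAdjoint (h Z))
    {X : Finset V} {a b : 𝒜} (ha : ∀ Z ⊆ Λ, Disjoint Z X → Commute (h Z) a)
    {β β' : ℝ → ℝ} (hβ0 : β 0 = 0) (hβ : ∀ τ, HasDerivAt β (β' τ) τ) {t : ℝ} (ht : 0 ≤ t)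
    (hb : ∀ τ, 0 ≤ τ → ∑ Z ∈ Λ.powerset with ¬ Disjoint Z X,
      ‖heisenberg (∑ Z ∈ Λ.powerset, h Z) τ (h Z) * b -
        b * heisenberg (∑ Z ∈ Λ.powerset, h Z) τ (h Z)‖ ≤ β' τ)
    {s : ℂ} (hs : ‖s‖ ≤ 1) :
    ‖heisenberg (∑ Z ∈ Λ.powerset, h Z) t a * b +
        s • (b * heisenberg (∑ Z ∈ Λ.powerset, h Z) t a)‖ ≤
      ‖a * b + s • (b * a)‖ + 2 * ‖a‖ * β t := by
  refine norm_heisenberg_comm_le (H' := ∑ Z ∈ Λ.powerset with Disjoint Z X, h Z)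
    (isSelfAdjoint_sum _ fun Z hZ => hsa Z (Finset.mem_powerset.1 hZ))
    (isSelfAdjoint_sum _ fun Z hZ => hsa Z (Finset.mem_powerset.1 (Finset.mem_filter.1 hZ).1))
    (Commute.sum_right _ _ _ fun Z hZ => ?_) hβ0 hβ ht (fun τ hτ => ?_) hs
  · rw [Finset.mem_filter, Finset.mem_powerset] at hZ
    exact (ha Z hZ.1 hZ.2).symm
  · rw [sum_powerset_sub_disjoint]
    exact (norm_comm_heisenberg_sum_le _ _ _ _ _).trans (hb τ hτ)

theorem hasDerivAt_iterate_bound (hv : v ≠ 0) (B c S : ℝ) (n : ℕ) (τ : ℝ) :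
    HasDerivAt
      (fun τ => B * (S * ((Real.exp (v * τ) - 1) / v) + c ^ n * τ ^ (n + 1) / (n + 1).factorial))
      (B * (S * Real.exp (v * τ) + (c * τ) ^ n / n.factorial)) τ := by
  have h1 : HasDerivAt (fun τ => Real.exp (v * τ)) (Real.exp (v * τ) * v) τ := by
    simpa using ((hasDerivAt_id τ).const_mul v).exp
  have h2 := ((h1.sub_const 1).div_const v).const_mul S
  have h3 := ((hasDerivAt_pow (n + 1) τ).const_mul (c ^ n)).div_const ((n + 1).factorial : ℝ)
  refine ((h2.add h3).const_mul B).congr_deriv ?_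
  rw [mul_div_assoc, div_self hv, mul_one, mul_pow, Nat.factorial_succ]
  have : ((n : ℝ) + 1) ≠ 0 := by positivity
  have : (n.factorial : ℝ) ≠ 0 := by positivity
  push_cast
  field_simp

/-- Induction on the number of Duhamel steps. The kernel inequality turns the sum over the terms
meeting `Z` into `v` times the kernel sum of `Z`, so after integration the first term reproduces
itself. The second term bounds what the first `n` steps have not resolved; there the crude total
norm of the interaction suffices. -/
theorem comm_interaction_iterate (hsa : ∀ Z ⊆ Λ, IsSelfAdjoint (h Z))
    (hcomm : ∀ Z ⊆ Λ, ∀ Z' ⊆ Λ, Disjoint Z Z' → Commute (h Z) (h Z'))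
    (hφ : IsPropagationKernel Λ (fun Z => ‖h Z‖) φ v) (hv : 0 < v)
    {Y : Finset V} (hY : Y ⊆ Λ) {b : 𝒜} (hb : ∀ Z ⊆ Λ, Disjoint Z Y → Commute (h Z) b)
    (n : ℕ) : ∀ Z ⊆ Λ, ∀ t, 0 ≤ t →
      ‖heisenberg (∑ Z ∈ Λ.powerset, h Z) t (h Z) * b -
        b * heisenberg (∑ Z ∈ Λ.powerset, h Z) t (h Z)‖ ≤
      2 * ‖h Z‖ * ‖b‖ * ((∑ z ∈ Z, ∑ y ∈ Y, φ z y) * Real.exp (v * t) +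
        ((2 * ∑ Z ∈ Λ.powerset, ‖h Z‖) * t) ^ n / n.factorial) := by
  have hS : ∀ Z, 0 ≤ ∑ z ∈ Z, ∑ y ∈ Y, φ z y := fun Z =>
    Finset.sum_nonneg fun z _ => Finset.sum_nonneg fun y _ => hφ.nonneg z y
  have hH : IsSelfAdjoint (∑ Z ∈ Λ.powerset, h Z) :=
    isSelfAdjoint_sum _ fun Z hZ => hsa Z (Finset.mem_powerset.1 hZ)
  set c : ℝ := 2 * ∑ Z ∈ Λ.powerset, ‖h Z‖ with hc
  have hc0 : 0 ≤ c := by positivity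
  have hm1 : ‖(-1 : ℂ)‖ ≤ 1 := by simp
  induction n with
  -- The trivial bound by twice the product of the norms is absorbed by the remainder, which equals
  -- `1` for `n = 0`.
  | zero =>
    intro Z hZ t ht
    have h1 := norm_mul_add_smul_mul_le (heisenberg (∑ Z ∈ Λ.powerset, h Z) t (h Z)) b hm1
    rw [norm_heisenberg hH, neg_one_smul, ← sub_eq_add_neg] at h1
    refine h1.trans (le_mul_of_one_le_right (by positivity) ?_)
    have := mul_nonneg (hS Z) (Real.exp_pos (v * t)).le
    simpa using this
  | succ n ih =>
    intro Z hZ t ht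
    have key := norm_heisenberg_comm_le_of_local (b := b) hsa (X := Z) (a := h Z)
      (fun Z' hZ' hd => hcomm Z' hZ' Z hZ hd)
      (β := fun τ => ∑ Z' ∈ Λ.powerset with ¬ Disjoint Z' Z, (2 * ‖h Z'‖ * ‖b‖) *
        ((∑ z ∈ Z', ∑ y ∈ Y, φ z y) * ((Real.exp (v * τ) - 1) / v) +
          c ^ n * τ ^ (n + 1) / (n + 1).factorial))
      (by simp) (fun τ => HasDerivAt.fun_sum fun Z' _ => hasDerivAt_iterate_bound hv.ne' _ _ _ _ _)
      ht (fun τ hτ => Finset.sum_le_sum fun Z' hZ' =>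
        ih Z' (Finset.mem_powerset.1 (Finset.mem_filter.1 hZ').1) τ hτ) hm1
    rw [neg_one_smul, ← sub_eq_add_neg, neg_one_smul, ← sub_eq_add_neg] at key
    refine key.trans ?_
    have hexp : 0 ≤ Real.exp (v * t) - 1 := by
      have := Real.one_le_exp (mul_nonneg hv.le ht); linarith
    -- At time zero the commutator vanishes unless `Z` meets `Y`; at a common point `φ x x = 1`, so
    -- the kernel sum is at least `1`.
    have h0 : ‖h Z * b - b * h Z‖ ≤ 2 * ‖h Z‖ * ‖b‖ * ∑ z ∈ Z, ∑ y ∈ Y, φ z y := by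
      by_cases hd : Disjoint Z Y
      · rw [(hb Z hZ hd).eq, sub_self, norm_zero]
        exact mul_nonneg (by positivity) (hS Z)
      · obtain ⟨x, hxZ, hxY⟩ := Finset.not_disjoint_iff.1 hd
        have h1 := norm_mul_add_smul_mul_le (h Z) b hm1
        rw [neg_one_smul, ← sub_eq_add_neg] at h1
        refine h1.trans (le_mul_of_one_le_right (by positivity) ?_)
        calc (1 : ℝ) = φ x x := (hφ.diag x).symm
          _ ≤ ∑ y ∈ Y, φ x y :=
            Finset.single_le_sum (f := fun y => φ x y) (fun y _ => hφ.nonneg x y) hxY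
          _ ≤ _ := Finset.single_le_sum (f := fun z => ∑ y ∈ Y, φ z y)
            (fun z _ => Finset.sum_nonneg fun y _ => hφ.nonneg z y) hxZ
    have h1 : ∑ Z' ∈ Λ.powerset with ¬ Disjoint Z' Z, (2 * ‖h Z'‖ * ‖b‖) *
        ((∑ z ∈ Z', ∑ y ∈ Y, φ z y) * ((Real.exp (v * t) - 1) / v) +
          c ^ n * t ^ (n + 1) / (n + 1).factorial) ≤
        ‖b‖ * ((∑ z ∈ Z, ∑ y ∈ Y, φ z y) * (Real.exp (v * t) - 1) +
          (c * t) ^ (n + 1) / (n + 1).factorial) := by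
      calc _ = ‖b‖ * ((∑ Z' ∈ Λ.powerset with ¬ Disjoint Z' Z,
              2 * ‖h Z'‖ * ∑ z ∈ Z', ∑ y ∈ Y, φ z y) * ((Real.exp (v * t) - 1) / v) +
            (∑ Z' ∈ Λ.powerset with ¬ Disjoint Z' Z, 2 * ‖h Z'‖) *
              (c ^ n * t ^ (n + 1) / (n + 1).factorial)) := by
            rw [Finset.sum_mul, Finset.sum_mul, ← Finset.sum_add_distrib, Finset.mul_sum]
            exact Finset.sum_congr rfl fun Z' _ => by ring
        _ ≤ ‖b‖ * ((v * ∑ z ∈ Z, ∑ y ∈ Y, φ z y) * ((Real.exp (v * t) - 1) / v) +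
            c * (c ^ n * t ^ (n + 1) / (n + 1).factorial)) := by
            have e1 := hφ.sum_le (fun Z => norm_nonneg _) hZ hY
            have e2 : ∑ Z' ∈ Λ.powerset with ¬ Disjoint Z' Z, 2 * ‖h Z'‖ ≤ c := by
              rw [hc, Finset.mul_sum]
              exact Finset.sum_le_sum_of_subset_of_nonneg (Finset.filter_subset _ _)
                fun _ _ _ => by positivity
            gcongr
        _ = _ := by
            rw [mul_assoc v, mul_left_comm v, mul_div_cancel₀ _ hv.ne', mul_pow c t (n + 1)]
            ring
    calc _ ≤ 2 * ‖h Z‖ * ‖b‖ * ∑ z ∈ Z, ∑ y ∈ Y, φ z y + 2 * ‖h Z‖ *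
          (‖b‖ * ((∑ z ∈ Z, ∑ y ∈ Y, φ z y) * (Real.exp (v * t) - 1) +
          (c * t) ^ (n + 1) / (n + 1).factorial)) := by
          gcongr
      _ = _ := by ring

/-- Letting the number of iterations tend to infinity removes the only volume-dependent term. -/
theorem norm_comm_interaction_le (hsa : ∀ Z ⊆ Λ, IsSelfAdjoint (h Z))
    (hcomm : ∀ Z ⊆ Λ, ∀ Z' ⊆ Λ, Disjoint Z Z' → Commute (h Z) (h Z'))
    (hφ : IsPropagationKernel Λ (fun Z => ‖h Z‖) φ v) (hv : 0 < v)
    {Y : Finset V} (hY : Y ⊆ Λ) {b : 𝒜} (hb : ∀ Z ⊆ Λ, Disjoint Z Y → Commute (h Z) b)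
    {Z : Finset V} (hZ : Z ⊆ Λ) {t : ℝ} (ht : 0 ≤ t) :
    ‖heisenberg (∑ Z ∈ Λ.powerset, h Z) t (h Z) * b -
        b * heisenberg (∑ Z ∈ Λ.powerset, h Z) t (h Z)‖ ≤
      2 * ‖h Z‖ * ‖b‖ * ((∑ z ∈ Z, ∑ y ∈ Y, φ z y) * Real.exp (v * t)) := by
  refine ge_of_tendsto' (x := atTop) ?_
    fun n => comm_interaction_iterate hsa hcomm hφ hv hY hb n Z hZ t ht
  have := (FloorSemiring.tendsto_pow_div_factorial_atTop
    ((2 * ∑ Z ∈ Λ.powerset, ‖h Z‖) * t)).const_add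
      ((∑ z ∈ Z, ∑ y ∈ Y, φ z y) * Real.exp (v * t))
  rw [add_zero] at this
  exact this.const_mul _

/-- One more Duhamel step, now for `a`. As the (anti)commutator vanishes at time zero, integrating
`v * exp (v * τ)` leaves `exp (v * t) - 1`. -/
theorem lieb_robinson_of_nonneg (hsa : ∀ Z ⊆ Λ, IsSelfAdjoint (h Z))
    (hcomm : ∀ Z ⊆ Λ, ∀ Z' ⊆ Λ, Disjoint Z Z' → Commute (h Z) (h Z'))
    (hφ : IsPropagationKernel Λ (fun Z => ‖h Z‖) φ v) (hv : 0 < v)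
    {X Y : Finset V} (hX : X ⊆ Λ) (hY : Y ⊆ Λ) {a b : 𝒜}
    (ha : ∀ Z ⊆ Λ, Disjoint Z X → Commute (h Z) a)
    (hb : ∀ Z ⊆ Λ, Disjoint Z Y → Commute (h Z) b)
    {s : ℂ} (hs : ‖s‖ ≤ 1) (hab : a * b + s • (b * a) = 0) {t : ℝ} (ht : 0 ≤ t) :
    ‖heisenberg (∑ Z ∈ Λ.powerset, h Z) t a * b +
        s • (b * heisenberg (∑ Z ∈ Λ.powerset, h Z) t a)‖ ≤
      2 * ‖a‖ * ‖b‖ * (∑ x ∈ X, ∑ y ∈ Y, φ x y) * (Real.exp (v * t) - 1) := by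
  have hexp : 0 ≤ Real.exp (v * t) - 1 := by
    have := Real.one_le_exp (mul_nonneg hv.le ht); linarith
  have key := norm_heisenberg_comm_le_of_local (b := b) hsa ha
    (β := fun τ => ∑ Z ∈ Λ.powerset with ¬ Disjoint Z X, (2 * ‖h Z‖ * ‖b‖) *
      ((∑ z ∈ Z, ∑ y ∈ Y, φ z y) * ((Real.exp (v * τ) - 1) / v)))
    (β' := fun τ => ∑ Z ∈ Λ.powerset with ¬ Disjoint Z X, (2 * ‖h Z‖ * ‖b‖) *
      ((∑ z ∈ Z, ∑ y ∈ Y, φ z y) * Real.exp (v * τ)))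
    (by simp) (fun τ => HasDerivAt.fun_sum fun Z _ => by
      -- With `c = 0` and `n = 1` the remainder and its derivative vanish; `n = 0` would leave `0 ^
      -- 0 = 1`.
      simpa using hasDerivAt_iterate_bound hv.ne' (2 * ‖h Z‖ * ‖b‖) 0 (∑ z ∈ Z, ∑ y ∈ Y, φ z y) 1 τ)
    ht (fun τ hτ => Finset.sum_le_sum fun Z hZ => norm_comm_interaction_le hsa hcomm hφ hv hY hb
      (Finset.mem_powerset.1 (Finset.mem_filter.1 hZ).1) hτ) hs
  rw [hab, norm_zero, zero_add] at key
  refine key.trans ?_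
  calc _ = 2 * ‖a‖ * (‖b‖ * ((∑ Z ∈ Λ.powerset with ¬ Disjoint Z X,
          2 * ‖h Z‖ * ∑ z ∈ Z, ∑ y ∈ Y, φ z y) * ((Real.exp (v * t) - 1) / v))) := by
        congr 1
        rw [Finset.sum_mul, Finset.mul_sum]
        exact Finset.sum_congr rfl fun Z' _ => by ring
    _ ≤ 2 * ‖a‖ * (‖b‖ * ((v * ∑ x ∈ X, ∑ y ∈ Y, φ x y) * ((Real.exp (v * t) - 1) / v))) := by
        have e1 := hφ.sum_le (fun Z => norm_nonneg _) hX hY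
        gcongr
    _ = _ := by field_simp

/-- The Lieb–Robinson bound for commutators (`s = -1`) and anticommutators (`s = 1`). -/
theorem lieb_robinson (hsa : ∀ Z ⊆ Λ, IsSelfAdjoint (h Z))
    (hcomm : ∀ Z ⊆ Λ, ∀ Z' ⊆ Λ, Disjoint Z Z' → Commute (h Z) (h Z'))
    (hφ : IsPropagationKernel Λ (fun Z => ‖h Z‖) φ v) (hv : 0 < v)
    {X Y : Finset V} (hX : X ⊆ Λ) (hY : Y ⊆ Λ) {a b : 𝒜}
    (ha : ∀ Z ⊆ Λ, Disjoint Z X → Commute (h Z) a)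
    (hb : ∀ Z ⊆ Λ, Disjoint Z Y → Commute (h Z) b)
    {s : ℂ} (hs : ‖s‖ ≤ 1) (hab : a * b + s • (b * a) = 0) (t : ℝ) :
    ‖heisenberg (∑ Z ∈ Λ.powerset, h Z) t a * b +
        s • (b * heisenberg (∑ Z ∈ Λ.powerset, h Z) t a)‖ ≤
      2 * ‖a‖ * ‖b‖ * (∑ x ∈ X, ∑ y ∈ Y, φ x y) * (Real.exp (v * |t|) - 1) := by
  rcases le_total 0 t with ht | ht
  · rw [abs_of_nonneg ht]
    exact lieb_robinson_of_nonneg hsa hcomm hφ hv hX hY ha hb hs hab ht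
  -- Time reversal amounts to changing the sign of the interaction, which preserves all hypotheses.
  · rw [abs_of_nonpos ht]
    have := lieb_robinson_of_nonneg (h := fun Z => -h Z) (fun Z hZ => (hsa Z hZ).neg)
      (fun Z hZ Z' hZ' hd => ((hcomm Z hZ Z' hZ' hd).neg_left).neg_right)
      (by simpa using hφ) hv hX hY (fun Z hZ hd => (ha Z hZ hd).neg_left)
      (fun Z hZ hd => (hb Z hZ hd).neg_left) hs hab (t := -t) (by linarith)
    simpa only [Finset.sum_neg_distrib, heisenberg_neg_left, neg_neg] using this

end LiebRobinson

/-! ### Propagation kernels of power-law and exponentially decaying interactions -/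

namespace IsPropagationKernel

variable {V : Type u} [DecidableEq V] {Λ : Finset V} {w : Finset V → ℝ} {φ : V → V → ℝ} {v : ℝ}

/-- Exchanging the sums over `Z` and over `z ∈ Z` leaves, for each `z`, the total weight of the sets
containing both `x` and `z`, which is at most `J x z`. -/
theorem of_pairwise (h0 : ∀ x y, 0 ≤ φ x y) (h1 : ∀ x, φ x x = 1) {J : V → V → ℝ}
    (hJ : ∀ x ∈ Λ, ∀ z ∈ Λ, ∑ Z ∈ Λ.powerset with x ∈ Z ∧ z ∈ Z, w Z ≤ J x z)
    (hconv : ∀ x ∈ Λ, ∀ y ∈ Λ, 2 * ∑ z ∈ Λ, J x z * φ z y ≤ v * φ x y) :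
    IsPropagationKernel Λ w φ v := by
  refine ⟨h0, h1, fun x hx y hy => le_trans ?_ (hconv x hx y hy)⟩
  refine mul_le_mul_of_nonneg_left ?_ zero_le_two
  calc ∑ Z ∈ Λ.powerset with x ∈ Z, w Z * ∑ z ∈ Z, φ z y
      = ∑ Z ∈ Λ.powerset with x ∈ Z, ∑ z ∈ Λ, if z ∈ Z then w Z * φ z y else 0 := by
        refine Finset.sum_congr rfl fun Z hZ => ?_
        have hZΛ := Finset.mem_powerset.1 (Finset.mem_filter.1 hZ).1
        rw [← Finset.sum_filter, Finset.filter_mem_eq_inter, Finset.inter_eq_right.2 hZΛ,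
          Finset.mul_sum]
    _ = ∑ z ∈ Λ, (∑ Z ∈ Λ.powerset with x ∈ Z ∧ z ∈ Z, w Z) * φ z y := by
        rw [Finset.sum_comm]
        refine Finset.sum_congr rfl fun z _ => ?_
        rw [← Finset.sum_filter, Finset.filter_filter, Finset.sum_mul]
    _ ≤ ∑ z ∈ Λ, J x z * φ z y :=
        Finset.sum_le_sum fun z hz => mul_le_mul_of_nonneg_right (hJ x hx z hz) (h0 z y)

/-- The number `m Z` is the price of moving the first argument of the kernel within `Z`; summing
over the points of `Z` produces the factor `Z.card`. -/
theorem of_summed (h0 : ∀ x y, 0 ≤ φ x y) (h1 : ∀ x, φ x x = 1) (hw : ∀ Z, 0 ≤ w Z)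
    {m : Finset V → ℝ} {s : ℝ}
    (hm : ∀ Z ⊆ Λ, ∀ x ∈ Z, ∀ z ∈ Z, ∀ y ∈ Λ, φ z y ≤ m Z * φ x y)
    (hs : ∀ x ∈ Λ, ∑ Z ∈ Λ.powerset with x ∈ Z, w Z * (Z.card : ℝ) * m Z ≤ s)
    (hv : 2 * s ≤ v) : IsPropagationKernel Λ w φ v := by
  refine ⟨h0, h1, fun x hx y hy => le_trans ?_ (mul_le_mul_of_nonneg_right hv (h0 x y))⟩
  rw [mul_assoc]
  refine mul_le_mul_of_nonneg_left ?_ zero_le_two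
  refine le_trans ?_ (mul_le_mul_of_nonneg_right (hs x hx) (h0 x y))
  rw [Finset.sum_mul]
  refine Finset.sum_le_sum fun Z hZ => ?_
  rw [Finset.mem_filter, Finset.mem_powerset] at hZ
  calc w Z * ∑ z ∈ Z, φ z y ≤ w Z * ∑ z ∈ Z, m Z * φ x y :=
        mul_le_mul_of_nonneg_left
          (Finset.sum_le_sum fun z hz => hm Z hZ.1 x hZ.2 z hz y hy) (hw Z)
    _ = _ := by rw [Finset.sum_const, nsmul_eq_mul]; ring

end IsPropagationKernel

/-- Reachability matters because `dist` is `0` between different components. -/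
theorem _root_.SimpleGraph.Reachable.dist_triangle' {V : Type*} {G : SimpleGraph V} {x y z : V}
    (hxy : G.Reachable x y) (hyz : G.Reachable y z) : G.dist x z ≤ G.dist x y + G.dist y z := by
  obtain ⟨p, hp⟩ := hxy.exists_walk_length_eq_dist
  obtain ⟨q, hq⟩ := hyz.exists_walk_length_eq_dist
  rw [← hp, ← hq, ← SimpleGraph.Walk.length_append]
  exact SimpleGraph.dist_le _

theorem dist_le_setDiam {V : Type u} (G : SimpleGraph V) {X : Finset V} {x y : V} (hx : x ∈ X)
    (hy : y ∈ X) : G.dist x y ≤ setDiam G X :=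
  (Finset.le_sup (f := fun y => G.dist x y) hy).trans
    (Finset.le_sup (f := fun x => X.sup fun y => G.dist x y) hx)

theorem setDist_le {V : Type u} (G : SimpleGraph V) {X Y : Finset V} {x y : V} (hx : x ∈ X)
    (hy : y ∈ Y) : setDist G X Y ≤ G.dist x y :=
  Nat.sInf_le ⟨x, hx, y, hy, rfl⟩

theorem disjoint_of_setDist_pos {V : Type u} {G : SimpleGraph V} {X Y : Finset V}
    (h : 0 < setDist G X Y) : Disjoint X Y := by
  rw [Finset.disjoint_left]
  intro x hx hy
  have := setDist_le G hx hy
  rw [SimpleGraph.dist_self] at this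
  omega

/-- The exponent of the constant is the maximum of `η * log (1 + r) - ε * r` over `r > -1`, taken at
`1 + r = η / ε`. The inequality is `log x ≤ x - 1` at `x = (ε / η) * (1 + r)`. -/
theorem exp_neg_le_rpow {ε η r : ℝ} (hε : 0 < ε) (hη : 0 < η) (hr : 0 ≤ r) :
    Real.exp (-ε * r) ≤ Real.exp (ε - η - η * Real.log (ε / η)) * (1 / (1 + r) ^ η) := by
  have h1 : 0 < 1 + r := by linarith
  have h2 : 0 < ε / η := div_pos hε hη
  have h3 := Real.log_le_sub_one_of_pos (mul_pos h2 h1)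
  rw [Real.log_mul h2.ne' h1.ne'] at h3
  have h4 : η * (ε / η * (1 + r)) = ε * (1 + r) := by field_simp
  have h5 := mul_le_mul_of_nonneg_left h3 hη.le
  rw [one_div, ← Real.rpow_neg h1.le, Real.rpow_def_of_pos h1, ← Real.exp_add]
  apply Real.exp_le_exp.2
  nlinarith

/-- A velocity for power-law decaying interactions. -/
def powerVelocity : PowerConstants → ℝ
  | .pairwise lam p => 1 + 2 * |lam * p|
  | .summed s => 1 + 2 * |s|

/-- A velocity for exponentially decaying interactions. -/
def expVelocity : ExpConstants → ℝ
  | .pairwise lam ε η K => 1 + 2 * |lam * (Real.exp (ε - η - η * Real.log (ε / η)) * K)|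
  | .summed s => 1 + 2 * |s|

theorem powerVelocity_pos (κ : PowerConstants) : 0 < powerVelocity κ := by
  cases κ <;> simp only [powerVelocity] <;> positivity

theorem expVelocity_pos (κ : ExpConstants) : 0 < expVelocity κ := by
  cases κ <;> simp only [expVelocity] <;> positivity

/-! ### Decay conditions, propagation kernels and the group velocity -/

namespace LatticeSystem

variable {V : Type u} [LinearOrder V] {k d : V → ℕ} (S : LatticeSystem k d)

theorem dist_triangle (n : ℕ) {x y z : V} (hx : x ∈ S.sites n) (hy : y ∈ S.sites n)
    (hz : z ∈ S.sites n) :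
    (S.graph n).dist x z ≤ (S.graph n).dist x y + (S.graph n).dist y z :=
  (S.connected n x hx y hy).dist_triangle' (S.connected n y hy z hz)

/-- The interaction of `S` propagates with velocity `v` inside the light cone described by `f`. -/
def PropagatesAs (f : ℝ → ℝ) (v : ℝ) : Prop :=
  ∀ n, IsPropagationKernel (S.sites n) (fun Z => ‖S.h n Z‖)
    (fun x y => f ((S.graph n).dist x y)) v

variable {S}

/-- In the pairwise form the convolution condition is the kernel inequality itself, with velocity `2
* lam * p`. In the summed form the price of moving inside `Z` is `(1 + diam Z) ^ η`, because `1 +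
dist x y ≤ (1 + diam Z) * (1 + dist z y)`. -/
theorem PowerLaw.propagatesAs {η : ℝ} (hη : 0 < η) {κ : PowerConstants} (h : S.PowerLaw η κ) :
    S.PropagatesAs (fun r => (1 + r) ^ (-η)) (powerVelocity κ) := by
  intro n
  have hpos : ∀ r : ℕ, (0 : ℝ) < 1 + (r : ℝ) := fun r => by positivity
  have h0 : ∀ x y, (0 : ℝ) ≤ (1 + ((S.graph n).dist x y : ℝ)) ^ (-η) := fun x y =>
    Real.rpow_nonneg (hpos _).le _
  have h1 : ∀ x, (1 + ((S.graph n).dist x x : ℝ)) ^ (-η) = 1 := fun x => by simp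
  cases κ with
  | pairwise lam p =>
    obtain ⟨hlam, hp, hJ, hconv⟩ := h
    refine IsPropagationKernel.of_pairwise h0 h1 (fun x hx z hz => hJ n x hx z hz)
      fun x hx y hy => ?_
    have := hconv n x hx y hy
    simp only [Real.rpow_neg (hpos _).le, powerVelocity]
    calc 2 * ∑ z ∈ S.sites n, lam / (1 + ((S.graph n).dist x z : ℝ)) ^ η *
            ((1 + ((S.graph n).dist z y : ℝ)) ^ η)⁻¹
        = 2 * lam * ∑ z ∈ S.sites n, 1 / (1 + ((S.graph n).dist x z : ℝ)) ^ η *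
            (1 / (1 + ((S.graph n).dist z y : ℝ)) ^ η) := by
          rw [Finset.mul_sum, Finset.mul_sum]
          exact Finset.sum_congr rfl fun z _ => by ring
      _ ≤ 2 * lam * (p / (1 + ((S.graph n).dist x y : ℝ)) ^ η) := by gcongr
      _ = 2 * (lam * p) * ((1 + ((S.graph n).dist x y : ℝ)) ^ η)⁻¹ := by ring
      _ ≤ _ := by
          have h2 := le_abs_self (lam * p)
          have h3 := Real.rpow_nonneg (hpos ((S.graph n).dist x y)).le η
          gcongr
          linarith
  | summed s =>
    obtain ⟨hs, hsum⟩ := h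
    refine IsPropagationKernel.of_summed h0 h1 (fun _ => norm_nonneg _)
      (fun Z hZ x hx z hz y hy => ?_) (fun x hx => hsum n x hx)
      (by simp only [powerVelocity]; linarith [le_abs_self s])
    beta_reduce
    rw [Real.rpow_neg (hpos _).le, Real.rpow_neg (hpos _).le, ← div_eq_mul_inv,
      le_div_iff₀ (Real.rpow_pos_of_pos (hpos _) _), inv_mul_le_iff₀ (Real.rpow_pos_of_pos (hpos _) _),
      ← Real.mul_rpow (hpos _).le (hpos _).le]
    refine Real.rpow_le_rpow (hpos _).le ?_ hη.le
    have h2 : ((S.graph n).dist x y : ℝ) ≤ (S.graph n).dist x z + (S.graph n).dist z y := by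
      exact_mod_cast S.dist_triangle n (hZ hx) (hZ hz) hy
    have h3 : ((S.graph n).dist x z : ℝ) ≤ setDiam (S.graph n) Z := by
      exact_mod_cast dist_le_setDiam _ hx hz
    have h4 : (0 : ℝ) ≤ (S.graph n).dist z y := Nat.cast_nonneg _
    have h5 : (0 : ℝ) ≤ setDiam (S.graph n) Z := Nat.cast_nonneg _
    nlinarith

/-- In the pairwise form the triangle inequality spends the rate `μ` on `exp (-μ * dist x y)`; the
spare factor `exp (-ε * dist x z)` is dominated by the power `η` and is therefore summable over `z`.
In the summed form the price of moving inside `Z` is `exp (μ * diam Z)`. -/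
theorem ExpDecay.propagatesAs {μ : ℝ} (hμ : 0 < μ) {κ : ExpConstants} (h : S.ExpDecay μ κ) :
    S.PropagatesAs (fun r => Real.exp (-(μ * r))) (expVelocity κ) := by
  intro n
  have h0 : ∀ x y, (0 : ℝ) ≤ Real.exp (-(μ * ((S.graph n).dist x y : ℝ))) := fun x y =>
    (Real.exp_pos _).le
  have h1 : ∀ x, Real.exp (-(μ * ((S.graph n).dist x x : ℝ))) = 1 := fun x => by simp
  cases κ with
  | pairwise lam ε η K =>
    obtain ⟨hlam, hε, hη, hK, hJ⟩ := h
    refine IsPropagationKernel.of_pairwise h0 h1 (fun x hx z hz => hJ n x hx z hz)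
      fun x hx y hy => ?_
    simp only [expVelocity]
    set c := Real.exp (ε - η - η * Real.log (ε / η)) with hc
    have hc0 : 0 < c := Real.exp_pos _
    calc 2 * ∑ z ∈ S.sites n, lam * Real.exp (-(μ + ε) * ((S.graph n).dist x z : ℝ)) *
            Real.exp (-(μ * ((S.graph n).dist z y : ℝ)))
        ≤ 2 * ∑ z ∈ S.sites n, lam * (c * (1 / (1 + ((S.graph n).dist x z : ℝ)) ^ η)) *
            Real.exp (-(μ * ((S.graph n).dist x y : ℝ))) := by
          refine mul_le_mul_of_nonneg_left (Finset.sum_le_sum fun z hz => ?_) zero_le_two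
          have e1 := exp_neg_le_rpow hε hη (Nat.cast_nonneg ((S.graph n).dist x z))
          have e2 : ((S.graph n).dist x y : ℝ) ≤ (S.graph n).dist x z + (S.graph n).dist z y := by
            exact_mod_cast S.dist_triangle n hx hz hy
          calc _ = lam * (Real.exp (-ε * ((S.graph n).dist x z : ℝ)) *
                Real.exp (-(μ * ((S.graph n).dist x z + (S.graph n).dist z y)))) := by
                rw [mul_assoc, ← Real.exp_add, ← Real.exp_add]
                congr 2
                ring
            _ ≤ lam * ((c * (1 / (1 + ((S.graph n).dist x z : ℝ)) ^ η)) *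
                Real.exp (-(μ * ((S.graph n).dist x y : ℝ)))) := by
                gcongr
            _ = _ := by ring
      _ = 2 * (lam * (c * ∑ z ∈ S.sites n, 1 / (1 + ((S.graph n).dist x z : ℝ)) ^ η)) *
            Real.exp (-(μ * ((S.graph n).dist x y : ℝ))) := by
          rw [← Finset.sum_mul, ← Finset.mul_sum, ← Finset.mul_sum]
          ring
      _ ≤ 2 * (lam * (c * K)) * Real.exp (-(μ * ((S.graph n).dist x y : ℝ))) := by
          gcongr
          exact hK n x hx
      _ ≤ _ := by
          gcongr
          linarith [le_abs_self (lam * (c * K))]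
  | summed s =>
    obtain ⟨hs, hsum⟩ := h
    refine IsPropagationKernel.of_summed h0 h1 (fun _ => norm_nonneg _)
      (fun Z hZ x hx z hz y hy => ?_) (fun x hx => hsum n x hx)
      (by simp only [expVelocity]; linarith [le_abs_self s])
    beta_reduce
    rw [← Real.exp_add]
    apply Real.exp_le_exp.2
    have h2 : ((S.graph n).dist x y : ℝ) ≤ (S.graph n).dist x z + (S.graph n).dist z y := by
      exact_mod_cast S.dist_triangle n (hZ hx) (hZ hz) hy
    have h3 : ((S.graph n).dist x z : ℝ) ≤ setDiam (S.graph n) Z := by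
      exact_mod_cast dist_le_setDiam _ hx hz
    nlinarith

theorem commute_h {n : ℕ} {Z : Finset V} (hZ : Z ⊆ S.sites n) {X : Finset V} (hX : X ⊆ S.sites n)
    {A : Op k d} (hA : A ∈ localAlgebra k d X) (hd : Disjoint Z X) : Commute (S.h n Z) A :=
  sub_eq_zero.1 (S.h_bosonic n Z hZ X hX A hA hd)

theorem kernel_sum_le {f : ℝ → ℝ} (hf : AntitoneOn f (Set.Ici 0)) (n : ℕ) (X Y : Finset V) :
    ∑ x ∈ X, ∑ y ∈ Y, f ((S.graph n).dist x y) ≤ X.card * Y.card * f (setDist (S.graph n) X Y) := by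
  calc _ ≤ ∑ x ∈ X, ∑ y ∈ Y, f (setDist (S.graph n) X Y) :=
        Finset.sum_le_sum fun x hx => Finset.sum_le_sum fun y hy =>
          hf (Nat.cast_nonneg _ : (0 : ℝ) ≤ _) (Nat.cast_nonneg _ : (0 : ℝ) ≤ _)
            (by exact_mod_cast setDist_le (S.graph n) hx hy)
    _ = _ := by simp [mul_assoc]

/-- The velocity of the propagation kernel bounds the group velocity. -/
theorem PropagatesAs.isGroupVelocityBound {f : ℝ → ℝ} {v : ℝ} (h : S.PropagatesAs f v)
    (hf : AntitoneOn f (Set.Ici 0)) (hv : 0 < v) : S.IsGroupVelocityBound f 2 v := by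
  intro n X hX Y hY hXY A hA B hB t
  have hd := disjoint_of_setDist_pos hXY
  have key : ∀ s : ℂ, ‖s‖ ≤ 1 → A * B + s • (B * A) = 0 →
      ‖S.evolve n t A * B + s • (B * S.evolve n t A)‖ ≤ 2 * ‖A‖ * ‖B‖ * X.card * Y.card *
          f (setDist (S.graph n) X Y) * (Real.exp (v * |t|) - 1) := by
    intro s hs hAB
    have e : heisenberg (∑ Z ∈ (S.sites n).powerset, S.h n Z) t A = S.evolve n t A := by
      simp [heisenberg, propagator, evolve, hamiltonian]
    have h1 := lieb_robinson (fun Z hZ => S.h_selfAdjoint n Z hZ)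
      (fun Z hZ Z' hZ' hd => commute_h hZ hZ' (S.h_mem n Z' hZ') hd) (h n) hv hX hY
      (fun Z hZ hd => commute_h hZ hX hA hd) (fun Z hZ hd => commute_h hZ hY hB hd) hs hAB t
    rw [e] at h1
    refine h1.trans ?_
    have h2 := kernel_sum_le (S := S) hf n X Y
    have h3 : 0 ≤ Real.exp (v * |t|) - 1 := by
      have := Real.one_le_exp (mul_nonneg hv.le (abs_nonneg t)); linarith
    calc _ ≤ 2 * ‖A‖ * ‖B‖ * (X.card * Y.card * f (setDist (S.graph n) X Y)) *
          (Real.exp (v * |t|) - 1) := by gcongr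
      _ = _ := by ring
  constructor
  · intro hp
    have := key (-1) (by simp) (by rw [neg_one_smul, ← sub_eq_add_neg]; exact hp hd)
    rwa [neg_one_smul, ← sub_eq_add_neg] at this
  · intro hp
    have := key 1 (by simp) (by rw [one_smul]; exact hp hd)
    rwa [one_smul] at this

end LatticeSystem

theorem antitoneOn_one_add_rpow_neg {η : ℝ} (hη : 0 ≤ η) :
    AntitoneOn (fun r : ℝ => (1 + r) ^ (-η)) (Set.Ici 0) := by
  intro r hr r' _ h
  have hr : 0 ≤ r := hr
  exact Real.rpow_le_rpow_of_nonpos (by linarith) (by linarith) (by linarith)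

theorem antitoneOn_exp_neg_mul {μ : ℝ} (hμ : 0 ≤ μ) :
    AntitoneOn (fun r : ℝ => Real.exp (-(μ * r))) (Set.Ici 0) := by
  intro r _ r' _ h
  exact Real.exp_le_exp.2 (neg_le_neg (mul_le_mul_of_nonneg_left h hμ))

/-! ### A Gaussian approximation of the sign function -/

section SignFilter

open MeasureTheory Set Real

/-- A smooth approximation of the sign function whose Fourier transform decays like a Gaussian. -/
def signFilter (α E : ℝ) : ℝ :=
  2 / π * ∫ t in Ioi (0 : ℝ), exp (-α * t ^ 2) * (sin (t * E) / t)

/-- The derivative of `signFilter`. -/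
def gaussianDensity (α s : ℝ) : ℝ := √(1 / (π * α)) * exp (-(1 / (4 * α)) * s ^ 2)

variable {α : ℝ}

theorem gaussianDensity_nonneg (s : ℝ) : 0 ≤ gaussianDensity α s := by
  unfold gaussianDensity; positivity

theorem gaussianDensity_le (hα : 0 < α) (s : ℝ) : gaussianDensity α s ≤ √(1 / (π * α)) := by
  refine mul_le_of_le_one_right (sqrt_nonneg _) (exp_le_one_iff.2 ?_)
  have : 0 ≤ 1 / (4 * α) * s ^ 2 := by positivity
  linarith

theorem continuous_gaussianDensity : Continuous (gaussianDensity α) := by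
  unfold gaussianDensity; fun_prop

theorem integrable_gaussianDensity (hα : 0 < α) : Integrable (gaussianDensity α) :=
  (integrable_exp_neg_mul_sq (by positivity)).const_mul _

theorem integral_gaussianDensity_Ioi (hα : 0 < α) :
    ∫ s in Ioi (0 : ℝ), gaussianDensity α s = 1 := by
  unfold gaussianDensity
  rw [integral_const_mul, integral_gaussian_Ioi, ← mul_div_assoc, ← sqrt_mul (by positivity)]
  have : 1 / (π * α) * (π / (1 / (4 * α))) = 2 ^ 2 := by
    have := pi_pos
    field_simp
    norm_num
  rw [this, sqrt_sq (by norm_num)]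
  norm_num

theorem abs_sin_mul_div_le (t E : ℝ) : |sin (t * E) / t| ≤ |E| := by
  rcases eq_or_ne t 0 with rfl | ht
  · simp
  · rw [abs_div, div_le_iff₀ (abs_pos.2 ht), mul_comm, ← abs_mul]
    exact abs_sin_le_abs

theorem integrableOn_signFilter (hα : 0 < α) (E : ℝ) :
    IntegrableOn (fun t => exp (-α * t ^ 2) * (sin (t * E) / t)) (Ioi (0 : ℝ)) := by
  refine Integrable.mono' ((integrable_exp_neg_mul_sq hα).mul_const |E|).integrableOn
    (Measurable.aestronglyMeasurable (by fun_prop)) (Eventually.of_forall fun t => ?_)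
  rw [norm_mul, norm_eq_abs, norm_eq_abs, abs_exp]
  exact mul_le_mul_of_nonneg_left (abs_sin_mul_div_le t E) (exp_pos _).le

theorem integral_exp_neg_mul_sq_mul_cos (hα : 0 < α) (E : ℝ) :
    ∫ t : ℝ, exp (-α * t ^ 2) * cos (t * E) = √(π / α) * exp (-(1 / (4 * α)) * E ^ 2) := by
  have h := fourierIntegral_gaussian (b := (α : ℂ)) (by simpa using hα) (E : ℂ)
  have h2 := congrArg Complex.re h
  have e1 : ((π : ℂ) / (α : ℂ)) ^ (1 / 2 : ℂ) = ((√(π / α) : ℝ) : ℂ) := by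
    rw [sqrt_eq_rpow, Complex.ofReal_cpow (by positivity)]
    push_cast
    rfl
  have e2 : Complex.exp (-(E : ℂ) ^ 2 / (4 * (α : ℂ))) =
      ((exp (-(1 / (4 * α)) * E ^ 2) : ℝ) : ℂ) := by
    push_cast
    congr 1
    ring
  rw [e1, e2, ← Complex.ofReal_mul, Complex.ofReal_re] at h2
  rw [← h2, ← RCLike.re_eq_complex_re, ← integral_re]
  · refine integral_congr_ae (Eventually.of_forall fun t => ?_)
    have e3 : Complex.exp (-(α : ℂ) * (t : ℂ) ^ 2) = ((exp (-α * t ^ 2) : ℝ) : ℂ) := by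
      push_cast; rfl
    have e4 : Complex.I * (E : ℂ) * (t : ℂ) = ((t * E : ℝ) : ℂ) * Complex.I := by
      push_cast; ring
    simp only [e3, e4, RCLike.re_eq_complex_re]
    rw [Complex.re_mul_ofReal, Complex.exp_ofReal_mul_I_re, mul_comm]
  · have := integrable_cexp_neg_mul_sq (b := (α : ℂ)) (by simpa using hα)
    refine this.bdd_mul (c := 1) (by fun_prop) (Eventually.of_forall fun t => ?_)
    have e4 : Complex.I * (E : ℂ) * (t : ℂ) = ((t * E : ℝ) : ℂ) * Complex.I := by
      push_cast; ring
    rw [e4, Complex.norm_exp_ofReal_mul_I]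

/-- Differentiation under the integral cancels the `1 / t` and leaves the cosine transform of a
Gaussian. -/
theorem hasDerivAt_signFilter (hα : 0 < α) (E : ℝ) :
    HasDerivAt (signFilter α) (gaussianDensity α E) E := by
  have h := (hasDerivAt_integral_of_dominated_loc_of_deriv_le (μ := volume.restrict (Ioi (0 : ℝ)))
    (F := fun E t => exp (-α * t ^ 2) * (sin (t * E) / t))
    (F' := fun E t => exp (-α * t ^ 2) * cos (t * E)) (x₀ := E)
    (bound := fun t => exp (-α * t ^ 2)) (s := univ) univ_mem
    (Eventually.of_forall fun E => Measurable.aestronglyMeasurable (by fun_prop))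
    (integrableOn_signFilter hα E) (by fun_prop)
    (Eventually.of_forall fun t E _ => by
      rw [norm_mul, norm_eq_abs, norm_eq_abs, abs_exp]
      exact mul_le_of_le_one_right (exp_pos _).le (abs_cos_le_one _))
    (integrable_exp_neg_mul_sq hα).integrableOn
    ((ae_restrict_iff' measurableSet_Ioi).2 (Eventually.of_forall fun t ht E _ => by
      have ht : t ≠ 0 := (mem_Ioi.1 ht).ne'
      have h1 := (((hasDerivAt_id E).const_mul t).sin.div_const t).const_mul (exp (-α * t ^ 2))
      refine h1.congr_deriv ?_
      simp only [id, mul_one]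
      rw [mul_div_cancel_right₀ _ ht]))).2
  have h2 := h.const_mul (2 / π)
  refine h2.congr_deriv ?_
  -- The integrand is even, so the half-line integral is half of the Fourier integral over the line.
  have h3 := integral_comp_abs (f := fun t => exp (-α * t ^ 2) * cos (t * E))
  have h4 : ∀ t : ℝ, exp (-α * |t| ^ 2) * cos (|t| * E) = exp (-α * t ^ 2) * cos (t * E) := by
    intro t
    rcases abs_cases t with ⟨h, _⟩ | ⟨h, _⟩ <;> simp [h]
  simp only [h4] at h3
  rw [integral_exp_neg_mul_sq_mul_cos hα] at h3
  rw [gaussianDensity, div_mul_eq_mul_div, ← h3, mul_div_right_comm]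
  congr 1
  rw [div_eq_iff pi_ne_zero, eq_comm]
  nth_rewrite 2 [← sqrt_sq pi_pos.le]
  rw [← sqrt_mul (by positivity)]
  congr 1
  field_simp

theorem signFilter_zero : signFilter α 0 = 0 := by simp [signFilter]

/-- This controls the energy differences inside the sector, which are small but need not vanish. -/
theorem abs_signFilter_le (hα : 0 < α) (E : ℝ) : |signFilter α E| ≤ √(1 / (π * α)) * |E| := by
  have := (convex_univ (𝕜 := ℝ) (E := ℝ)).norm_image_sub_le_of_norm_hasDerivWithin_le
    (f := signFilter α) (f' := gaussianDensity α) (C := √(1 / (π * α)))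
    (fun x _ => (hasDerivAt_signFilter hα x).hasDerivWithinAt)
    (fun x _ => by
      rw [norm_eq_abs, abs_of_nonneg (gaussianDensity_nonneg x)]
      exact gaussianDensity_le hα x) (mem_univ 0) (mem_univ E)
  simpa [signFilter_zero] using this

theorem one_sub_signFilter (hα : 0 < α) (E : ℝ) :
    1 - signFilter α E = ∫ s in Ioi E, gaussianDensity α s := by
  have h1 := intervalIntegral.integral_interval_add_Ioi
    (integrable_gaussianDensity hα).integrableOn (integrable_gaussianDensity hα).integrableOn
    (a := 0) (b := E)
  rw [integral_gaussianDensity_Ioi hα, intervalIntegral.integral_eq_sub_of_hasDerivAt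
    (fun x _ => hasDerivAt_signFilter hα x) (continuous_gaussianDensity.intervalIntegrable _ _),
    signFilter_zero, sub_zero] at h1
  linarith

/-- The error is a Gaussian tail. After the shift by `Δ`, `(s + Δ) ^ 2 ≥ s ^ 2 + Δ ^ 2` splits off
the exponential, and the rest has total mass `1`. -/
theorem abs_one_sub_signFilter_le (hα : 0 < α) {Δ E : ℝ} (hΔ : 0 ≤ Δ) (hE : Δ ≤ E) :
    |1 - signFilter α E| ≤ exp (-(1 / (4 * α)) * Δ ^ 2) := by
  rw [one_sub_signFilter hα, abs_of_nonneg (integral_nonneg gaussianDensity_nonneg)]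
  have h1 := (measurePreserving_add_right (volume : Measure ℝ) Δ).setIntegral_preimage_emb
    (measurableEmbedding_addRight Δ) (gaussianDensity α) (Ioi Δ)
  calc ∫ s in Ioi E, gaussianDensity α s ≤ ∫ s in Ioi Δ, gaussianDensity α s :=
        setIntegral_mono_set (integrable_gaussianDensity hα).integrableOn
          (Eventually.of_forall gaussianDensity_nonneg)
          (Ioi_subset_Ioi hE).eventuallyLE
    _ = ∫ s in Ioi (0 : ℝ), gaussianDensity α (s + Δ) := by
        rw [← h1]; simp
    _ ≤ ∫ s in Ioi (0 : ℝ), exp (-(1 / (4 * α)) * Δ ^ 2) * gaussianDensity α s := by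
        refine setIntegral_mono_on ((integrable_gaussianDensity hα).comp_add_right Δ).integrableOn
          ((integrable_gaussianDensity hα).const_mul _).integrableOn measurableSet_Ioi
          fun s hs => ?_
        have hs : 0 < s := hs
        unfold gaussianDensity
        rw [mul_left_comm, ← exp_add]
        refine mul_le_mul_of_nonneg_left (exp_le_exp.2 ?_) (sqrt_nonneg _)
        have : 0 ≤ 1 / (4 * α) * (2 * s * Δ) := by positivity
        nlinarith
    _ = _ := by rw [integral_const_mul, integral_gaussianDensity_Ioi hα, mul_one]

theorem integral_mul_exp_neg_mul_sq_Ioi (hα : 0 < α) (T : ℝ) :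
    ∫ t in Ioi T, t * exp (-α * t ^ 2) = exp (-α * T ^ 2) / (2 * α) := by
  have hd : ∀ t ∈ Ici T, HasDerivAt (fun t => -(exp (-α * t ^ 2) / (2 * α)))
      (t * exp (-α * t ^ 2)) t := by
    intro t _
    have h1 := ((((hasDerivAt_pow 2 t).const_mul (-α)).exp).div_const (2 * α)).neg
    refine h1.congr_deriv ?_
    field_simp
    push_cast
    ring
  have hlim : Tendsto (fun t : ℝ => -(exp (-α * t ^ 2) / (2 * α))) atTop (𝓝 0) := by
    have h1 : Tendsto (fun t : ℝ => -α * t ^ 2) atTop atBot :=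
      (tendsto_pow_atTop two_ne_zero).const_mul_atTop_of_neg (by linarith)
    simpa using ((tendsto_exp_atBot.comp h1).div_const (2 * α)).neg
  rw [integral_Ioi_of_hasDerivAt_of_tendsto' hd (integrable_mul_exp_neg_mul_sq hα).integrableOn hlim]
  ring

/-- The chord of a convex function. The linear factor `t` compensates the singularity `1 / t` of the
time integral. -/
theorem exp_mul_sub_one_le {v t T : ℝ} (hT : 0 < T) (ht : 0 ≤ t) (htT : t ≤ T) :
    exp (v * t) - 1 ≤ t / T * (exp (v * T) - 1) := by
  have h1 : t / T ≤ 1 := (div_le_one hT).2 htT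
  have h := convexOn_exp.2 (mem_univ 0) (mem_univ (v * T)) (sub_nonneg.2 h1)
    (div_nonneg ht hT.le) (by ring)
  simp only [smul_eq_mul, mul_zero, zero_add, exp_zero, mul_one] at h
  have e : t / T * (v * T) = v * t := by field_simp
  rw [e] at h
  linarith

/-- Splitting the time integral at `T`: inside use the light-cone bound, outside the trivial one. -/
theorem norm_integral_time_le (hα : 0 < α) {c M v T : ℝ} (hc : 0 ≤ c) (hT : 0 < T)
    {ψ : ℝ → ℂ} (h1 : ∀ t, 0 < t → ‖ψ t‖ ≤ c * (exp (v * t) - 1)) (h2 : ∀ t, 0 < t → ‖ψ t‖ ≤ M) :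
    ‖∫ t in Ioi (0 : ℝ), ((exp (-α * t ^ 2) / t : ℝ) : ℂ) * ψ t‖ ≤
      c * (exp (v * T) - 1) + M * (exp (-α * T ^ 2) / (2 * α * T ^ 2)) := by
  have hM : 0 ≤ M := (norm_nonneg _).trans (h2 1 one_pos)
  -- Beyond `T` the weight `1 / t` is replaced by the larger `t / T ^ 2`, so that the Gaussian tail
  -- has an explicit primitive.
  let D : ℝ → ℝ := fun t => if t ≤ T then c * (exp (v * T) - 1) / T else
    M / T ^ 2 * (t * exp (-α * t ^ 2))
  have hin : EqOn D (fun _ => c * (exp (v * T) - 1) / T) (Ioc 0 T) := fun t ht => if_pos ht.2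
  have hout : EqOn D (fun t => M / T ^ 2 * (t * exp (-α * t ^ 2))) (Ioi T) := fun t ht =>
    if_neg (not_le.2 ht)
  have i1 : IntegrableOn D (Ioc 0 T) :=
    (integrableOn_congr_fun hin measurableSet_Ioc).2 (integrableOn_const (by simp))
  have i2 : IntegrableOn D (Ioi T) :=
    (integrableOn_congr_fun hout measurableSet_Ioi).2
      ((integrable_mul_exp_neg_mul_sq hα).const_mul _).integrableOn
  have hD : ∫ t in Ioi (0 : ℝ), D t =
      c * (exp (v * T) - 1) + M * (exp (-α * T ^ 2) / (2 * α * T ^ 2)) := by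
    rw [← Ioc_union_Ioi_eq_Ioi hT.le, setIntegral_union (Ioc_disjoint_Ioi le_rfl) measurableSet_Ioi
      i1 i2, setIntegral_congr_fun measurableSet_Ioc hin, setIntegral_congr_fun measurableSet_Ioi hout,
      integral_const_mul, integral_mul_exp_neg_mul_sq_Ioi hα, setIntegral_const]
    simp only [measureReal_def, volume_Ioc, sub_zero, ENNReal.toReal_ofReal hT.le, smul_eq_mul]
    field_simp
  rw [← hD]
  refine norm_integral_le_of_norm_le (Ioc_union_Ioi_eq_Ioi hT.le ▸ i1.union i2)
    ((ae_restrict_iff' measurableSet_Ioi).2 (Eventually.of_forall fun t ht => ?_))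
  have ht : 0 < t := ht
  rw [norm_mul, Complex.norm_real, norm_eq_abs, abs_of_nonneg (by positivity)]
  by_cases htT : t ≤ T
  · rw [show D t = _ from if_pos htT]
    have e1 : exp (-α * t ^ 2) ≤ 1 := exp_le_one_iff.2 (by nlinarith [sq_nonneg t])
    calc exp (-α * t ^ 2) / t * ‖ψ t‖ ≤ 1 / t * (c * (t / T * (exp (v * T) - 1))) := by
          refine mul_le_mul (by gcongr) ((h1 t ht).trans ?_) (norm_nonneg _) (by positivity)
          exact mul_le_mul_of_nonneg_left (exp_mul_sub_one_le hT ht.le htT) hc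
      _ = _ := by field_simp
  · rw [show D t = _ from if_neg htT]
    have htT := not_le.1 htT
    calc exp (-α * t ^ 2) / t * ‖ψ t‖ ≤ exp (-α * t ^ 2) / t * M := by
          gcongr; exact h2 t ht
      _ = M * exp (-α * t ^ 2) * (1 / t) := by ring
      _ ≤ M * exp (-α * t ^ 2) * (t / T ^ 2) := by
          refine mul_le_mul_of_nonneg_left ?_ (by positivity)
          rw [div_le_div_iff₀ ht (by positivity), one_mul, ← sq]
          gcongr
      _ = _ := by ring

end SignFilter

/-! ### Spectral analysis of ground-state correlations in finite volume -/

section Spectral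

theorem norm_sum_inner_le {E : Type*} [NormedAddCommGroup E] [InnerProductSpace ℂ E] {ι : Type*}
    [Fintype ι] (e : OrthonormalBasis ι ℂ E) (a : E →L[ℂ] E) (I : Finset ι) :
    ‖∑ i ∈ I, ⟪e i, a (e i)⟫_ℂ‖ ≤ I.card * ‖a‖ := by
  refine (norm_sum_le_of_le I fun i _ => ?_).trans_eq (by rw [Finset.sum_const, nsmul_eq_mul])
  calc _ ≤ ‖e i‖ * ‖a (e i)‖ := norm_inner_le_norm _ _
    _ ≤ ‖e i‖ * (‖a‖ * ‖e i‖) := by gcongr; exact ContinuousLinearMap.le_opNorm _ _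
    _ = ‖a‖ := by simp

variable {E : Type*} [NormedAddCommGroup E] [InnerProductSpace ℂ E] [CompleteSpace E]
  {ι : Type*} [Fintype ι]

theorem exp_apply_of_eigenvector {x : E →L[ℂ] E} {w : E} {c : ℂ} (h : x w = c • w) :
    NormedSpace.exp x w = Complex.exp c • w := by
  have h1 := (NormedSpace.exp_series_hasSum_exp' (𝕂 := ℂ) x).mapL
    (ContinuousLinearMap.apply ℂ E w)
  have h2 := (NormedSpace.exp_series_hasSum_exp' (𝕂 := ℂ) c).smul_const w
  rw [← Complex.exp_eq_exp_ℂ] at h2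
  refine h1.unique (h2.congr_fun ?_)
  intro n
  have h3 : (x ^ n) w = c ^ n • w := by
    induction n with
    | zero => simp
    | succ n ih => rw [pow_succ', mul_apply_eq_comp, ih, map_smul, h, smul_smul, pow_succ]
  simp [h3, smul_smul]

theorem inner_propagator_left {H : E →L[ℂ] E} (hH : IsSelfAdjoint H) (t : ℝ) (x y : E) :
    ⟪x, propagator H t y⟫_ℂ = ⟪propagator H (-t) x, y⟫_ℂ := by
  have hs : star (propagator H t) = propagator H (-t) := by
    have h1 := (Unitary.mem_iff.1 (propagator_mem_unitary hH t)).1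
    calc star (propagator H t) = star (propagator H t) * (propagator H t * propagator H (-t)) := by
          rw [propagator_mul_neg, mul_one]
      _ = _ := by rw [← mul_assoc, h1, one_mul]
  rw [← hs, ContinuousLinearMap.star_eq_adjoint, ContinuousLinearMap.adjoint_inner_left]

theorem inner_heisenberg {H : E →L[ℂ] E} (hH : IsSelfAdjoint H) {x y : E} {r s : ℝ}
    (hx : H x = (r : ℂ) • x) (hy : H y = (s : ℂ) • y) (a : E →L[ℂ] E) (t : ℝ) :
    ⟪x, heisenberg H t a y⟫_ℂ = Complex.exp (((t * (r - s) : ℝ) : ℂ) * Complex.I) * ⟪x, a y⟫_ℂ := by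
  have h1 : ∀ {z : E} {q : ℝ} (_ : H z = (q : ℂ) • z) (t : ℝ),
      propagator H t z = Complex.exp (Complex.I * t * q) • z := fun hz t =>
    exp_apply_of_eigenvector (by rw [smul_apply, hz, smul_smul])
  rw [heisenberg, mul_apply_eq_comp, mul_apply_eq_comp,
    inner_propagator_left hH, h1 hx, h1 hy, map_smul, inner_smul_left, inner_smul_right,
    ← Complex.exp_conj, ← mul_assoc, ← Complex.exp_add]
  congr 2
  simp
  ring

theorem inner_mul_apply_eq_sum (e : OrthonormalBasis ι ℂ E) (a b : E →L[ℂ] E) (x y : E) :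
    ⟪x, (a * b) y⟫_ℂ = ∑ m, ⟪x, a (e m)⟫_ℂ * ⟪e m, b y⟫_ℂ := by
  rw [mul_apply_eq_comp, ← ContinuousLinearMap.adjoint_inner_left,
    ← e.sum_inner_mul_inner]
  simp_rw [ContinuousLinearMap.adjoint_inner_left]

/-- Cauchy–Schwarz and Parseval; the bound does not depend on the dimension, hence not on the
volume. -/
theorem sum_norm_inner_mul_le (e : OrthonormalBasis ι ℂ E) (a b : E →L[ℂ] E) (i : ι) :
    ∑ m, ‖⟪e i, a (e m)⟫_ℂ‖ * ‖⟪e m, b (e i)⟫_ℂ‖ ≤ ‖a‖ * ‖b‖ := by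
  have h1 : ∑ m, ‖⟪e i, a (e m)⟫_ℂ‖ ^ 2 ≤ ‖a‖ ^ 2 := by
    simp_rw [← ContinuousLinearMap.adjoint_inner_left]
    rw [e.sum_sq_norm_inner_left]
    gcongr
    calc _ ≤ ‖ContinuousLinearMap.adjoint a‖ * ‖e i‖ := ContinuousLinearMap.le_opNorm _ _
      _ = ‖a‖ := by simp
  have h2 : ∑ m, ‖⟪e m, b (e i)⟫_ℂ‖ ^ 2 ≤ ‖b‖ ^ 2 := by
    rw [e.sum_sq_norm_inner_right]
    gcongr
    calc _ ≤ ‖b‖ * ‖e i‖ := ContinuousLinearMap.le_opNorm _ _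
      _ = ‖b‖ := by simp
  have h3 := Finset.sum_mul_sq_le_sq_mul_sq Finset.univ (fun m => ‖⟪e i, a (e m)⟫_ℂ‖)
    (fun m => ‖⟪e m, b (e i)⟫_ℂ‖)
  refine abs_le_of_sq_le_sq' (h3.trans ?_) (by positivity) |>.2
  rw [mul_pow]
  gcongr

/-- The antisymmetric combination of matrix elements in an eigenbasis. -/
def commElement (e : OrthonormalBasis ι ℂ E) (a b : E →L[ℂ] E) (i m : ι) : ℂ :=
  ⟪e i, a (e m)⟫_ℂ * ⟪e m, b (e i)⟫_ℂ - ⟪e i, b (e m)⟫_ℂ * ⟪e m, a (e i)⟫_ℂ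

theorem sum_norm_commElement_le (e : OrthonormalBasis ι ℂ E) (a b : E →L[ℂ] E) (i : ι) :
    ∑ m, ‖commElement e a b i m‖ ≤ 2 * (‖a‖ * ‖b‖) := by
  calc _ ≤ ∑ m, (‖⟪e i, a (e m)⟫_ℂ‖ * ‖⟪e m, b (e i)⟫_ℂ‖ +
        ‖⟪e i, b (e m)⟫_ℂ‖ * ‖⟪e m, a (e i)⟫_ℂ‖) := by
        refine Finset.sum_le_sum fun m _ => ?_
        rw [commElement, ← norm_mul, ← norm_mul]
        exact norm_sub_le _ _
    _ ≤ _ := by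
        rw [Finset.sum_add_distrib]
        linarith [sum_norm_inner_mul_le e a b i, sum_norm_inner_mul_le e b a i, mul_comm ‖a‖ ‖b‖]

/-- The two products of matrix elements rotate with opposite phases. Taking the part odd in `t`
turns the phases into a sine and the sum of the products into their difference, so an anticommutator
yields `commElement`. -/
theorem anticomm_diff_eq {H : E →L[ℂ] E} (hH : IsSelfAdjoint H) (e : OrthonormalBasis ι ℂ E)
    {lam : ι → ℝ} (he : ∀ i, H (e i) = (lam i : ℂ) • e i) (a b : E →L[ℂ] E) (t : ℝ) (i : ι) :
    ⟪e i, (heisenberg H t a * b + b * heisenberg H t a) (e i)⟫_ℂ -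
      ⟪e i, (heisenberg H (-t) a * b + b * heisenberg H (-t) a) (e i)⟫_ℂ =
    ∑ m, -2 * Complex.I * (Real.sin (t * (lam m - lam i)) : ℂ) * commElement e a b i m := by
  simp only [add_apply, inner_add_right, inner_mul_apply_eq_sum e,
    inner_heisenberg hH (he _) (he _)]
  rw [← Finset.sum_add_distrib, ← Finset.sum_add_distrib, ← Finset.sum_sub_distrib]
  refine Finset.sum_congr rfl fun m _ => ?_
  have e1 : t * (lam i - lam m) = -(t * (lam m - lam i)) := by ring
  have e2 : -t * (lam i - lam m) = t * (lam m - lam i) := by ring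
  have e3 : -t * (lam m - lam i) = -(t * (lam m - lam i)) := by ring
  rw [e1, e2, e3, commElement]
  generalize t * (lam m - lam i) = θ
  rw [Complex.exp_mul_I, Complex.exp_mul_I, Complex.ofReal_neg, Complex.cos_neg, Complex.sin_neg,
    Complex.ofReal_sin]
  ring

-- The filtered sum is a time integral of expectations of the anticommutator, to which the
-- light-cone bound and the trivial bound apply. Both times `t` and `-t` occur, which doubles the
-- constants `c` and `2 * ‖a‖ * ‖b‖`.
open MeasureTheory in
theorem norm_sum_commElement_mul_signFilter_le {H : E →L[ℂ] E} (hH : IsSelfAdjoint H)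
    (e : OrthonormalBasis ι ℂ E) {lam : ι → ℝ} (he : ∀ i, H (e i) = (lam i : ℂ) • e i)
    {a b : E →L[ℂ] E} (I : Finset ι) {α c v T : ℝ} (hα : 0 < α) (hc : 0 ≤ c) (hT : 0 < T)
    (hLR : ∀ t, ‖heisenberg H t a * b + b * heisenberg H t a‖ ≤ c * (Real.exp (v * |t|) - 1)) :
    ‖∑ i ∈ I, ∑ m, commElement e a b i m * (signFilter α (lam m - lam i) : ℂ)‖ ≤
      I.card / Real.pi * (2 * c * (Real.exp (v * T) - 1) +
        4 * ‖a‖ * ‖b‖ * (Real.exp (-α * T ^ 2) / (2 * α * T ^ 2))) := by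
  let X : ℝ → E →L[ℂ] E := fun t => heisenberg H t a * b + b * heisenberg H t a
  let ψ : ℝ → ℂ := fun t => ∑ i ∈ I, (⟪e i, X t (e i)⟫_ℂ - ⟪e i, X (-t) (e i)⟫_ℂ)
  have hψ : ∀ t, ‖ψ t‖ ≤ I.card * (‖X t‖ + ‖X (-t)‖) := by
    intro t
    simp only [ψ]
    rw [Finset.sum_sub_distrib, mul_add]
    exact (norm_sub_le _ _).trans (add_le_add (norm_sum_inner_le e _ I) (norm_sum_inner_le e _ I))
  have hX : ∀ t, ‖X t‖ ≤ 2 * ‖a‖ * ‖b‖ := by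
    intro t
    have := norm_mul_add_smul_mul_le (heisenberg H t a) b (s := 1) (by simp)
    rwa [one_smul, norm_heisenberg hH] at this
  have key := norm_integral_time_le (c := I.card * (2 * c)) (M := I.card * (4 * ‖a‖ * ‖b‖))
    (v := v) (ψ := ψ) hα (by positivity) hT
    (fun t ht => (hψ t).trans (by
      have h1 := hLR t
      have h2 := hLR (-t)
      rw [abs_neg, abs_of_pos ht] at h2
      rw [abs_of_pos ht] at h1
      rw [mul_assoc]
      refine mul_le_mul_of_nonneg_left ?_ (Nat.cast_nonneg _)
      simp only [X]
      linarith))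
    (fun t _ => (hψ t).trans (by
      refine mul_le_mul_of_nonneg_left ?_ (Nat.cast_nonneg _)
      linarith [hX t, hX (-t)]))
  -- The factor is `-2 * I` from the sines times `π / 2` from the normalization of `signFilter`.
  have hint : ∫ t in Set.Ioi (0 : ℝ), ((Real.exp (-α * t ^ 2) / t : ℝ) : ℂ) * ψ t =
      -(Real.pi : ℂ) * Complex.I *
        ∑ i ∈ I, ∑ m, commElement e a b i m * (signFilter α (lam m - lam i) : ℂ) := by
    have e1 : ∀ t, ((Real.exp (-α * t ^ 2) / t : ℝ) : ℂ) * ψ t =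
        ∑ i ∈ I, ∑ m, (-2 * Complex.I * commElement e a b i m) *
          ((Real.exp (-α * t ^ 2) * (Real.sin (t * (lam m - lam i)) / t) : ℝ) : ℂ) := by
      intro t
      simp only [ψ, X, anticomm_diff_eq hH e he, Finset.mul_sum]
      refine Finset.sum_congr rfl fun i _ => Finset.sum_congr rfl fun m _ => ?_
      push_cast
      ring
    have hi : ∀ i m, Integrable (fun t : ℝ => (-2 * Complex.I * commElement e a b i m) *
        ((Real.exp (-α * t ^ 2) * (Real.sin (t * (lam m - lam i)) / t) : ℝ) : ℂ))
        (volume.restrict (Set.Ioi 0)) := fun i m =>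
      (integrableOn_signFilter hα (lam m - lam i)).ofReal.const_mul _
    simp_rw [e1]
    rw [integral_finsetSum _ fun i _ => integrable_finsetSum _ fun m _ => hi i m, Finset.mul_sum]
    refine Finset.sum_congr rfl fun i _ => ?_
    rw [integral_finsetSum _ fun m _ => hi i m, Finset.mul_sum]
    refine Finset.sum_congr rfl fun m _ => ?_
    rw [integral_const_mul, integral_complex_ofReal, signFilter]
    have := Complex.ofReal_ne_zero.2 Real.pi_ne_zero
    rw [Complex.ofReal_mul, Complex.ofReal_div]
    generalize ((∫ t in Set.Ioi (0 : ℝ), Real.exp (-α * t ^ 2) *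
      (Real.sin (t * (lam m - lam i)) / t) : ℝ) : ℂ) = J
    push_cast
    field_simp
  rw [hint, norm_mul, norm_mul, norm_neg, Complex.norm_I, mul_one, Complex.norm_real,
    Real.norm_eq_abs, abs_of_pos Real.pi_pos] at key
  rw [div_mul_eq_mul_div, le_div_iff₀ Real.pi_pos, mul_comm]
  refine key.trans_eq ?_
  ring

/-- The clustering estimate in a finite volume, in terms of an eigenbasis. `I` is the set of
eigenvectors in the ground state sector. -/
theorem norm_sum_inner_mul_le_of_gap {H : E →L[ℂ] E} (hH : IsSelfAdjoint H)
    (e : OrthonormalBasis ι ℂ E) {lam : ι → ℝ} (he : ∀ i, H (e i) = (lam i : ℂ) • e i)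
    {a b : E →L[ℂ] E} (hab : a * b + b * a = 0) (I : Finset ι) {α c v T Δ w : ℝ} (hα : 0 < α)
    (hc : 0 ≤ c) (hT : 0 < T) (hΔ : 0 ≤ Δ) (hw0 : 0 ≤ w)
    (hLR : ∀ t, ‖heisenberg H t a * b + b * heisenberg H t a‖ ≤ c * (Real.exp (v * |t|) - 1))
    (hgap : ∀ i ∈ I, ∀ m ∉ I, Δ ≤ lam m - lam i)
    (hwidth : ∀ i ∈ I, ∀ m ∈ I, |lam m - lam i| ≤ w) :
    ‖∑ i ∈ I, ⟪e i, (a * b) (e i)⟫_ℂ‖ ≤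
      I.card * (1 / Real.pi * (c * (Real.exp (v * T) - 1) +
        2 * ‖a‖ * ‖b‖ * (Real.exp (-α * T ^ 2) / (2 * α * T ^ 2))) +
        ‖a‖ * ‖b‖ * (Real.exp (-(1 / (4 * α)) * Δ ^ 2) + √(1 / (Real.pi * α)) * w)) := by
  classical
  -- Summing over all `m` gives the diagonal elements of `a * b - b * a`, which is `2 * (a * b)` by
  -- anticommutation.
  have h1 : ∑ i ∈ I, ∑ m, commElement e a b i m = 2 * ∑ i ∈ I, ⟪e i, (a * b) (e i)⟫_ℂ := by
    rw [Finset.mul_sum]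
    refine Finset.sum_congr rfl fun i _ => ?_
    simp only [commElement]
    rw [Finset.sum_sub_distrib, ← inner_mul_apply_eq_sum e, ← inner_mul_apply_eq_sum e,
      eq_neg_of_add_eq_zero_right hab]
    simp only [neg_apply, inner_neg_right]
    ring
  -- Exchanging `i` and `m` changes the sign, so transitions within the sector cancel in the trace.
  have h2 : ∑ i ∈ I, ∑ m ∈ I, commElement e a b i m = 0 := by
    simp only [commElement, Finset.sum_sub_distrib]
    rw [sub_eq_zero, Finset.sum_comm]
    exact Finset.sum_congr rfl fun i _ => Finset.sum_congr rfl fun m _ => mul_comm _ _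
  -- The error of the filter: the ideal coefficient is `1` outside the sector, and inside it may be
  -- taken to be `0` by the cancellation just shown.
  let R : ι → ι → ℝ := fun i m => (if m ∈ I then 0 else 1) - signFilter α (lam m - lam i)
  have h3 : 2 * ∑ i ∈ I, ⟪e i, (a * b) (e i)⟫_ℂ =
      ∑ i ∈ I, ∑ m, commElement e a b i m * (signFilter α (lam m - lam i) : ℂ) +
      ∑ i ∈ I, ∑ m, commElement e a b i m * (R i m : ℂ) := by
    rw [← h1, ← sub_eq_zero, ← Finset.sum_add_distrib, ← Finset.sum_sub_distrib, ← h2]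
    refine Finset.sum_congr rfl fun i _ => ?_
    rw [← Finset.sum_add_distrib, ← Finset.sum_sub_distrib,
      ← Finset.sum_filter_add_sum_filter_not Finset.univ (· ∈ I), Finset.filter_univ_mem,
      add_eq_left.2]
    · refine Finset.sum_congr rfl fun m hm => ?_
      simp [R, hm]
    · refine Finset.sum_eq_zero fun m hm => ?_
      simp only [R, if_neg (Finset.mem_filter.1 hm).2]
      push_cast
      ring
  set ε := Real.exp (-(1 / (4 * α)) * Δ ^ 2) + √(1 / (Real.pi * α)) * w with hε
  have hR : ∀ i ∈ I, ∀ m, |R i m| ≤ ε := by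
    intro i hi m
    by_cases hm : m ∈ I
    · simp only [R, if_pos hm, zero_sub, abs_neg]
      refine (abs_signFilter_le hα _).trans ?_
      have := mul_le_mul_of_nonneg_left (hwidth i hi m hm) (Real.sqrt_nonneg (1 / (Real.pi * α)))
      linarith [Real.exp_pos (-(1 / (4 * α)) * Δ ^ 2)]
    · simp only [R, if_neg hm]
      refine (abs_one_sub_signFilter_le hα hΔ (hgap i hi m hm)).trans ?_
      have := mul_nonneg (Real.sqrt_nonneg (1 / (Real.pi * α))) hw0
      linarith
  have h4 : ‖∑ i ∈ I, ∑ m, commElement e a b i m * (R i m : ℂ)‖ ≤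
      I.card * (2 * (‖a‖ * ‖b‖) * ε) := by
    refine (norm_sum_le_of_le I fun i hi => ?_).trans_eq (by rw [Finset.sum_const, nsmul_eq_mul])
    have hε0 : 0 ≤ ε := by positivity
    calc ‖∑ m, commElement e a b i m * (R i m : ℂ)‖ ≤ ∑ m, ‖commElement e a b i m‖ * ε := by
          refine norm_sum_le_of_le _ fun m _ => ?_
          rw [norm_mul, Complex.norm_real, Real.norm_eq_abs]
          exact mul_le_mul_of_nonneg_left (hR i hi m) (norm_nonneg _)
      _ ≤ _ := by
          rw [← Finset.sum_mul]
          exact mul_le_mul_of_nonneg_right (sum_norm_commElement_le e a b i) hε0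
  have h5 := norm_sum_commElement_mul_signFilter_le hH e he I hα hc hT hLR
  have h6 := (congrArg norm h3).trans_le ((norm_add_le _ _).trans (add_le_add h5 h4))
  rw [norm_mul, Complex.norm_two] at h6
  refine le_of_mul_le_mul_left (h6.trans_eq ?_) (zero_lt_two' ℝ)
  ring

end Spectral

/-! ### The projection onto the ground state sector in an eigenbasis -/

section Sector

variable {E : Type*} [NormedAddCommGroup E] [InnerProductSpace ℂ E] [FiniteDimensional ℂ E]

/-- The span of the eigenvectors of `H` with eigenvalues in `s`. -/
def sectorSpace (H : E →L[ℂ] E) (s : Finset ℝ) : Submodule ℂ E :=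
  ⨆ x ∈ s, Module.End.eigenspace (H : Module.End ℂ E) (x : ℂ)

theorem exists_eigenbasis [CompleteSpace E] {H : E →L[ℂ] E} (hH : IsSelfAdjoint H) :
    ∃ (n : ℕ) (e : OrthonormalBasis (Fin n) ℂ E) (lam : Fin n → ℝ),
      ∀ i, H (e i) = (lam i : ℂ) • e i :=
  ⟨_, hH.isSymmetric.eigenvectorBasis rfl, hH.isSymmetric.eigenvalues rfl,
    fun i => hH.isSymmetric.apply_eigenvectorBasis rfl i⟩

variable {ι : Type*} [Fintype ι]

theorem starProjection_sectorSpace_apply [CompleteSpace E] {H : E →L[ℂ] E} (hH : IsSelfAdjoint H)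
    (e : OrthonormalBasis ι ℂ E) {lam : ι → ℝ} (he : ∀ i, H (e i) = (lam i : ℂ) • e i)
    (s : Finset ℝ) (i : ι) :
    (sectorSpace H s).starProjection (e i) = if lam i ∈ s then e i else 0 := by
  split_ifs with hi
  · rw [Submodule.starProjection_eq_self_iff]
    refine Submodule.mem_iSup_of_mem (lam i) (Submodule.mem_iSup_of_mem hi ?_)
    exact Module.End.mem_eigenspace_iff.2 (he i)
  · rw [Submodule.starProjection_apply_eq_zero_iff, Submodule.mem_orthogonal]
    suffices h : sectorSpace H s ≤ (Submodule.span ℂ {e i})ᗮ from fun y hy =>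
      Submodule.mem_orthogonal_singleton_iff_inner_left.1 (h hy)
    refine iSup₂_le fun x hx y hy => Submodule.mem_orthogonal_singleton_iff_inner_left.2 ?_
    have hy : H y = (x : ℂ) • y := Module.End.mem_eigenspace_iff.1 hy
    have h1 : ⟪H y, e i⟫_ℂ = ⟪y, H (e i)⟫_ℂ := hH.isSymmetric y (e i)
    rw [hy, he, inner_smul_left, inner_smul_right, Complex.conj_ofReal, ← sub_eq_zero, ← sub_mul,
      mul_eq_zero] at h1
    refine h1.resolve_left fun h => hi ?_
    rw [sub_eq_zero, Complex.ofReal_inj] at h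
    exact h ▸ hx

theorem trace_comp_starProjection_sectorSpace [CompleteSpace E] {H : E →L[ℂ] E}
    (hH : IsSelfAdjoint H) (e : OrthonormalBasis ι ℂ E) {lam : ι → ℝ}
    (he : ∀ i, H (e i) = (lam i : ℂ) • e i) (s : Finset ℝ) (a : E →L[ℂ] E) :
    LinearMap.trace ℂ E (a ∘L (sectorSpace H s).starProjection).toLinearMap =
      ∑ i with lam i ∈ s, ⟪e i, a (e i)⟫_ℂ := by
  rw [LinearMap.trace_eq_sum_inner _ e, Finset.sum_filter]
  refine Finset.sum_congr rfl fun i _ => ?_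
  simp only [ContinuousLinearMap.coe_coe, ContinuousLinearMap.comp_apply,
    starProjection_sectorSpace_apply hH e he]
  split_ifs <;> simp

/-- The rank of a projection is its trace, which the eigenbasis evaluates as a count. -/
theorem finrank_sectorSpace [CompleteSpace E] {H : E →L[ℂ] E} (hH : IsSelfAdjoint H)
    (e : OrthonormalBasis ι ℂ E) {lam : ι → ℝ} (he : ∀ i, H (e i) = (lam i : ℂ) • e i)
    (s : Finset ℝ) :
    Module.finrank ℂ (sectorSpace H s) = (Finset.univ.filter fun i => lam i ∈ s).card := by
  have h1 := trace_comp_starProjection_sectorSpace hH e he s 1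
  have h2 : LinearMap.IsProj (sectorSpace H s)
      ((1 : E →L[ℂ] E) ∘L (sectorSpace H s).starProjection).toLinearMap :=
    ⟨fun x => by simp, fun x hx => by simpa using Submodule.starProjection_eq_self_iff.2 hx⟩
  rw [h2.trace] at h1
  simp only [one_apply_eq_self, inner_self_eq_norm_sq_to_K, e.norm_eq_one] at h1
  simpa using h1

end Sector

/-! ### Restriction of local observables to a finite volume -/

section Volume

open Classical in
/-- The restriction of a vector to the configurations in the finite volume. -/
def restrictOn {V : Type u} (k d : V → ℕ) (Λ : Finset V) : Op k d :=
  shiftOp (fun c => c ∈ configOn k d Λ) (fun _ => 1) id (Set.injOn_id _) (fun _ => by simp)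

open Classical in
theorem restrictOn_apply {V : Type u} {k d : V → ℕ} (Λ : Finset V) (f : Fock k d) (c : Config k d) :
    restrictOn k d Λ f c = if c ∈ configOn k d Λ then f c else 0 := by
  change (if c ∈ configOn k d Λ then 1 * f c else 0) = _
  rw [one_mul]

/-- Where it acts, the shift neither leaves nor enters the set of configurations of the volume. -/
theorem commute_shiftOp_restrictOn {V : Type u} {k d : V → ℕ} (Λ : Finset V)
    {p : Config k d → Prop} [DecidablePred p]
    {s : Config k d → ℂ} {g : Config k d → Config k d} (hg : Set.InjOn g {c | p c})
    (hs : ∀ c, ‖s c‖ ≤ 1) (h : ∀ c, p c → (g c ∈ configOn k d Λ ↔ c ∈ configOn k d Λ)) :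
    Commute (restrictOn k d Λ) (shiftOp p s g hg hs) := by
  classical
  change restrictOn k d Λ * shiftOp p s g hg hs = shiftOp p s g hg hs * restrictOn k d Λ
  ext f c
  rw [mul_apply_eq_comp, mul_apply_eq_comp, restrictOn_apply]
  change (if c ∈ configOn k d Λ then (if p c then s c * f (g c) else 0) else 0) =
    (if p c then s c * restrictOn k d Λ f (g c) else 0)
  rw [restrictOn_apply]
  by_cases hp : p c
  · simp only [if_pos hp, h c hp]
    split_ifs <;> simp
  · simp [hp]

variable {V : Type u} [LinearOrder V] {k d : V → ℕ}

theorem starProjection_fockOn (Λ : Finset V) :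
    (fockOn k d Λ).starProjection = restrictOn k d Λ := by
  ext1 f
  refine Submodule.eq_starProjection_of_mem_orthogonal (fun c hc => ?_) ?_
  · rw [restrictOn_apply, if_neg hc]
  · rw [Submodule.mem_orthogonal]
    intro g hg
    rw [lp.inner_eq_tsum]
    refine (tsum_congr fun c => ?_).trans tsum_zero
    rw [lp.coeFn_sub, Pi.sub_apply, restrictOn_apply]
    split_ifs with hc
    · simp
    · rw [hg c hc, inner_zero_left]

/-- The centralizer of the projection is a star subalgebra, so it suffices to check the generators,
and these change a configuration only at sites of `X ⊆ Λ`. On operators commuting with the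
projection `onVolume` is then multiplicative and norm-nonincreasing, so the hypotheses of the
Lieb–Robinson bound carry over to the volume. -/
theorem commute_starProjection_of_mem_localAlgebra {X Λ : Finset V} (hX : X ⊆ Λ) {A : Op k d}
    (hA : A ∈ localAlgebra k d X) : Commute (fockOn k d Λ).starProjection A := by
  suffices h : localAlgebra k d X ≤
      StarSubalgebra.centralizer ℂ {(fockOn k d Λ).starProjection} by
    have := (StarSubalgebra.mem_centralizer_iff ℂ).1 (h hA) _ (Set.mem_singleton _)
    exact this.1
  refine StarAlgebra.adjoin_le ?_
  have hP : star (fockOn k d Λ).starProjection = (fockOn k d Λ).starProjection :=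
    (isSelfAdjoint_starProjection _).star_eq
  have key : ∀ T : Op k d, Commute (restrictOn k d Λ) T →
      T ∈ StarSubalgebra.centralizer ℂ {(fockOn k d Λ).starProjection} := by
    intro T hT
    rw [StarSubalgebra.mem_centralizer_iff]
    rintro _ rfl
    rw [hP, starProjection_fockOn]
    exact ⟨hT, hT⟩
  rintro T (⟨m, hm, rfl⟩ | ⟨x, hx, i, j, rfl⟩)
  · refine key _ (commute_shiftOp_restrictOn Λ _ _ fun c _ => ?_)
    refine and_congr_left fun _ => ⟨fun h m' hm' => h m' (Finset.mem_insert_of_mem hm'),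
      fun h m' hm' => ?_⟩
    rcases Finset.mem_insert.1 hm' with rfl | h'
    · exact hX hm
    · exact h m' h'
  · refine key _ (commute_shiftOp_restrictOn Λ _ _ fun c _ => ?_)
    refine and_congr_right fun _ => forall₂_congr fun y hy => ?_
    have : y ≠ x := fun h => hy (h ▸ hX hx)
    simp [Function.update_of_ne this]

theorem onVolume_apply {Λ : Finset V} {A : Op k d} (hA : Commute (fockOn k d Λ).starProjection A)
    (x : fockOn k d Λ) : (onVolume Λ A x : Fock k d) = A x := by
  have h1 : (onVolume Λ A x : Fock k d) = ((fockOn k d Λ).starProjection * A) x := rfl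
  rw [h1, hA.eq, mul_apply_eq_comp, Submodule.starProjection_eq_self_iff.2 x.2]

theorem onVolume_mul {Λ : Finset V} {A B : Op k d}
    (hA : Commute (fockOn k d Λ).starProjection A) (hB : Commute (fockOn k d Λ).starProjection B) :
    onVolume Λ (A * B) = onVolume Λ A * onVolume Λ B := by
  ext1 x
  apply Subtype.ext
  rw [onVolume_apply (hA.mul_right hB), mul_apply_eq_comp, mul_apply_eq_comp, onVolume_apply hA,
    onVolume_apply hB]

theorem onVolume_add (Λ : Finset V) (A B : Op k d) :
    onVolume Λ (A + B) = onVolume Λ A + onVolume Λ B := by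
  simp [onVolume]

theorem onVolume_zero (Λ : Finset V) : onVolume Λ (0 : Op k d) = 0 := by
  simp [onVolume]

theorem onVolume_sum (Λ : Finset V) {ι : Type*} (s : Finset ι) (f : ι → Op k d) :
    onVolume Λ (∑ i ∈ s, f i) = ∑ i ∈ s, onVolume Λ (f i) :=
  map_sum (⟨⟨onVolume Λ, onVolume_zero Λ⟩, onVolume_add Λ⟩ : Op k d →+ _) f s

theorem norm_onVolume_le {Λ : Finset V} {A : Op k d}
    (hA : Commute (fockOn k d Λ).starProjection A) : ‖onVolume Λ A‖ ≤ ‖A‖ := by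
  refine ContinuousLinearMap.opNorm_le_bound _ (norm_nonneg _) fun x => ?_
  change ‖(onVolume Λ A x : Fock k d)‖ ≤ ‖A‖ * ‖(x : Fock k d)‖
  rw [onVolume_apply hA]
  exact A.le_opNorm _

theorem isSelfAdjoint_onVolume {Λ : Finset V} {A : Op k d}
    (hA : Commute (fockOn k d Λ).starProjection A) (h : IsSelfAdjoint A) :
    IsSelfAdjoint (onVolume Λ A) := by
  rw [ContinuousLinearMap.isSelfAdjoint_iff_isSymmetric]
  intro x y
  simp only [ContinuousLinearMap.coe_coe]
  rw [Submodule.coe_inner, Submodule.coe_inner, onVolume_apply hA, onVolume_apply hA]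
  exact h.isSymmetric _ _

theorem commute_onVolume {Λ : Finset V} {A B : Op k d}
    (hA : Commute (fockOn k d Λ).starProjection A) (hB : Commute (fockOn k d Λ).starProjection B)
    (h : Commute A B) : Commute (onVolume Λ A) (onVolume Λ B) := by
  change onVolume Λ A * onVolume Λ B = onVolume Λ B * onVolume Λ A
  rw [← onVolume_mul hA hB, ← onVolume_mul hB hA, h.eq]

theorem commute_of_mem_localAlgebra_empty {A : Op k d} (hA : A ∈ localAlgebra k d ∅) (B : Op k d) :
    Commute A B := by
  have h : localAlgebra k d ∅ ≤ ⊥ := by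
    refine StarAlgebra.adjoin_le ?_
    rintro T (⟨m, hm, -⟩ | ⟨x, hx, -⟩)
    · simp at hm
    · simp at hx
  obtain ⟨c, rfl⟩ := StarSubalgebra.mem_bot.1 (h hA)
  exact Algebra.commutes c B

end Volume

/-! ### Finite-volume clustering and the infinite-volume limit -/

namespace LatticeSystem

variable {V : Type u} [LinearOrder V] {k d : V → ℕ} {S : LatticeSystem k d}

theorem commute_starProjection_h (n : ℕ) {Z : Finset V} (hZ : Z ⊆ S.sites n) :
    Commute (fockOn k d (S.sites n)).starProjection (S.h n Z) :=
  commute_starProjection_of_mem_localAlgebra hZ (S.h_mem n Z hZ)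

theorem isSelfAdjoint_onVolume_hamiltonian (n : ℕ) :
    IsSelfAdjoint (onVolume (S.sites n) (S.hamiltonian n)) :=
  isSelfAdjoint_onVolume
    (Commute.sum_right _ _ _ fun _ hZ => commute_starProjection_h n (Finset.mem_powerset.1 hZ))
    (isSelfAdjoint_sum _ fun Z hZ => S.h_selfAdjoint n Z (Finset.mem_powerset.1 hZ))

theorem expectation_eq (sector : ℕ → Finset ℝ) (n : ℕ) {ι : Type*} [Fintype ι]
    (e : OrthonormalBasis ι ℂ (fockOn k d (S.sites n))) {lam : ι → ℝ}
    (he : ∀ i, onVolume (S.sites n) (S.hamiltonian n) (e i) = (lam i : ℂ) • e i) (A : Op k d) :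
    S.expectation sector n A = ((Finset.univ.filter fun i => lam i ∈ sector n).card : ℂ)⁻¹ *
      ∑ i with lam i ∈ sector n, ⟪e i, onVolume (S.sites n) A (e i)⟫_ℂ := by
  rw [← finrank_sectorSpace (isSelfAdjoint_onVolume_hamiltonian n) e he,
    ← trace_comp_starProjection_sectorSpace (isSelfAdjoint_onVolume_hamiltonian n) e he]
  rfl

theorem norm_expectation_le_of_sum_le (sector : ℕ → Finset ℝ) (n : ℕ) {ι : Type*} [Fintype ι]
    (e : OrthonormalBasis ι ℂ (fockOn k d (S.sites n))) {lam : ι → ℝ}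
    (he : ∀ i, onVolume (S.sites n) (S.hamiltonian n) (e i) = (lam i : ℂ) • e i) {A : Op k d}
    {M : ℝ} (hM : 0 ≤ M) (h : ‖∑ i with lam i ∈ sector n, ⟪e i, onVolume (S.sites n) A (e i)⟫_ℂ‖ ≤
      (Finset.univ.filter fun i => lam i ∈ sector n).card * M) :
    ‖S.expectation sector n A‖ ≤ M := by
  rw [expectation_eq sector n e he, norm_mul, norm_inv, Complex.norm_natCast]
  exact inv_mul_le_of_le_mul₀ (Nat.cast_nonneg _) hM h

theorem norm_expectation_le (sector : ℕ → Finset ℝ) (n : ℕ) {A : Op k d}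
    (hA : Commute (fockOn k d (S.sites n)).starProjection A) :
    ‖S.expectation sector n A‖ ≤ ‖A‖ := by
  obtain ⟨N, e, lam, he⟩ := exists_eigenbasis (isSelfAdjoint_onVolume_hamiltonian (S := S) n)
  refine norm_expectation_le_of_sum_le sector n e he (norm_nonneg _)
    ((norm_sum_inner_le e _ _).trans ?_)
  exact mul_le_mul_of_nonneg_left (norm_onVolume_le hA) (Nat.cast_nonneg _)

/-- The abstract bound is applied to the compressed interaction itself: compression does not
increase norms, so the same kernel works, and the two dynamics need not be compared. -/
theorem norm_heisenberg_onVolume_anticomm_le {f : ℝ → ℝ} {v : ℝ} (h : S.PropagatesAs f v)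
    (hf : AntitoneOn f (Set.Ici 0)) (hf0 : ∀ r, 0 ≤ r → 0 ≤ f r) (hv : 0 < v) {n : ℕ}
    {X Y : Finset V} (hX : X ⊆ S.sites n) (hY : Y ⊆ S.sites n)
    {A B : Op k d} (hA : A ∈ localAlgebra k d X) (hB : B ∈ localAlgebra k d Y)
    (hab : onVolume (S.sites n) A * onVolume (S.sites n) B +
      onVolume (S.sites n) B * onVolume (S.sites n) A = 0) (t : ℝ) :
    ‖heisenberg (onVolume (S.sites n) (S.hamiltonian n)) t (onVolume (S.sites n) A) *
        onVolume (S.sites n) B + onVolume (S.sites n) B *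
        heisenberg (onVolume (S.sites n) (S.hamiltonian n)) t (onVolume (S.sites n) A)‖ ≤
      ‖A‖ * ‖B‖ * (2 * (X.card * Y.card * f (setDist (S.graph n) X Y))) *
        (Real.exp (v * |t|) - 1) := by
  have hPA := commute_starProjection_of_mem_localAlgebra hX hA
  have hPB := commute_starProjection_of_mem_localAlgebra hY hB
  have hPh : ∀ Z ⊆ S.sites n, Commute (fockOn k d (S.sites n)).starProjection (S.h n Z) :=
    fun Z hZ => commute_starProjection_h n hZ
  have hn : ‖onVolume (S.sites n) A‖ * ‖onVolume (S.sites n) B‖ ≤ ‖A‖ * ‖B‖ :=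
    mul_le_mul (norm_onVolume_le hPA) (norm_onVolume_le hPB)
      (norm_nonneg (onVolume (S.sites n) B)) (norm_nonneg A)
  have h1 := lieb_robinson (h := fun Z => onVolume (S.sites n) (S.h n Z))
    (fun Z hZ => isSelfAdjoint_onVolume (hPh Z hZ) (S.h_selfAdjoint n Z hZ))
    (fun Z hZ Z' hZ' hd => commute_onVolume (hPh Z hZ) (hPh Z' hZ')
      (commute_h hZ hZ' (S.h_mem n Z' hZ') hd))
    ((h n).mono fun Z hZ => norm_onVolume_le (hPh Z hZ)) hv hX hY
    (fun Z hZ hd => commute_onVolume (hPh Z hZ) hPA (commute_h hZ hX hA hd))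
    (fun Z hZ hd => commute_onVolume (hPh Z hZ) hPB (commute_h hZ hY hB hd))
    (s := 1) (by simp) (by rw [one_smul]; exact hab) t
  rw [one_smul, ← onVolume_sum] at h1
  refine h1.trans ?_
  have h2 := kernel_sum_le (S := S) hf n X Y
  have h3 : 0 ≤ Real.exp (v * |t|) - 1 := by
    have := Real.one_le_exp (mul_nonneg hv.le (abs_nonneg t)); linarith
  have h4 : 0 ≤ ∑ x ∈ X, ∑ y ∈ Y, f ((S.graph n).dist x y) :=
    Finset.sum_nonneg fun x _ => Finset.sum_nonneg fun y _ => hf0 _ (Nat.cast_nonneg _)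
  calc _ = 2 * (‖onVolume (S.sites n) A‖ * ‖onVolume (S.sites n) B‖) *
        (∑ x ∈ X, ∑ y ∈ Y, f ((S.graph n).dist x y)) * (Real.exp (v * |t|) - 1) := by ring
    _ ≤ 2 * (‖A‖ * ‖B‖) * (X.card * Y.card * f (setDist (S.graph n) X Y)) *
        (Real.exp (v * |t|) - 1) := by gcongr
    _ = _ := by ring

theorem clustering_bound_le {p q M c x z y : ℝ} (hpq : p * q ≤ M) (hz : 0 ≤ z) (hy : 0 ≤ y) :
    1 / Real.pi * (M * c * x + 2 * p * q * z) + p * q * y ≤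
      M * (1 / Real.pi * (c * x + 2 * z) + y) := by
  calc _ = 1 / Real.pi * (M * c * x + 2 * (p * q) * z) + (p * q) * y := by ring
    _ ≤ 1 / Real.pi * (M * c * x + 2 * M * z) + M * y := by gcongr
    _ = _ := by ring

/-- The clustering estimate for a fermionic pair in a finite volume. -/
theorem norm_expectation_mul_le {f : ℝ → ℝ} {v : ℝ} (h : S.PropagatesAs f v)
    (hf : AntitoneOn f (Set.Ici 0)) (hf0 : ∀ r, 0 ≤ r → 0 ≤ f r) (hv : 0 < v)
    {sector : ℕ → Finset ℝ} {ΔE : ℝ} (hΔ : 0 < ΔE) (hgap : S.HasUniformGap sector ΔE) {n : ℕ}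
    {X Y : Finset V} (hX : X ⊆ S.sites n) (hY : Y ⊆ S.sites n)
    {A B : Op k d} (hA : A ∈ localAlgebra k d X) (hB : B ∈ localAlgebra k d Y)
    (hAB : A * B + B * A = 0) {α T : ℝ} (hα : 0 < α) (hT : 0 < T) :
    ‖S.expectation sector n (A * B)‖ ≤ ‖A‖ * ‖B‖ *
      (1 / Real.pi * (2 * (X.card * Y.card * f (setDist (S.graph n) X Y)) * (Real.exp (v * T) - 1) +
        2 * (Real.exp (-α * T ^ 2) / (2 * α * T ^ 2))) +
        (Real.exp (-(1 / (4 * α)) * ΔE ^ 2) +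
          √(1 / (Real.pi * α)) * Metric.diam (sector n : Set ℝ))) := by
  obtain ⟨N, e, lam, he⟩ := exists_eigenbasis (isSelfAdjoint_onVolume_hamiltonian (S := S) n)
  have hPA := commute_starProjection_of_mem_localAlgebra hX hA
  have hPB := commute_starProjection_of_mem_localAlgebra hY hB
  have hc : 0 ≤ 2 * (X.card * Y.card * f (setDist (S.graph n) X Y)) :=
    mul_nonneg zero_le_two (mul_nonneg (mul_nonneg (Nat.cast_nonneg _) (Nat.cast_nonneg _))
      (hf0 _ (Nat.cast_nonneg _)))
  have hM : 0 ≤ ‖A‖ * ‖B‖ := mul_nonneg (norm_nonneg _) (norm_nonneg _)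
  have hab : onVolume (S.sites n) A * onVolume (S.sites n) B +
      onVolume (S.sites n) B * onVolume (S.sites n) A = 0 := by
    rw [← onVolume_mul hPA hPB, ← onVolume_mul hPB hPA, ← onVolume_add, hAB, onVolume_zero]
  have hdiam : 0 ≤ Metric.diam (sector n : Set ℝ) := Metric.diam_nonneg
  have hT' : 0 ≤ Real.exp (v * T) - 1 := by
    have := Real.one_le_exp (mul_nonneg hv.le hT.le); linarith
  have hn : ‖onVolume (S.sites n) A‖ * ‖onVolume (S.sites n) B‖ ≤ ‖A‖ * ‖B‖ :=
    mul_le_mul (norm_onVolume_le hPA) (norm_onVolume_le hPB)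
      (norm_nonneg (onVolume (S.sites n) B)) (norm_nonneg A)
  have hLR := norm_heisenberg_onVolume_anticomm_le h hf hf0 hv hX hY hA hB hab
  have hene : ∀ i, S.IsEnergy n (lam i) := fun i =>
    Module.End.hasEigenvalue_of_hasEigenvector
      ⟨Module.End.mem_eigenspace_iff.2 (he i), e.orthonormal.ne_zero i⟩
  have key := norm_sum_inner_mul_le_of_gap (isSelfAdjoint_onVolume_hamiltonian n) e he hab
    (Finset.univ.filter fun i => lam i ∈ sector n) (Δ := ΔE)
    (w := Metric.diam (sector n : Set ℝ)) hα (mul_nonneg hM hc) hT hΔ.le hdiam hLR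
    (fun i hi m hm => (hgap.gap n _ (Finset.mem_filter.1 hi).2 _ (hene m)
      fun h => hm (Finset.mem_filter.2 ⟨Finset.mem_univ _, h⟩)).le)
    (fun i hi m hm => by
      rw [← Real.dist_eq]
      exact Metric.dist_le_diam_of_mem (sector n).finite_toSet.isBounded
        (Finset.mem_coe.2 (Finset.mem_filter.1 hm).2) (Finset.mem_coe.2 (Finset.mem_filter.1 hi).2))
  rw [← onVolume_mul hPA hPB] at key
  have hu : 0 ≤ Real.exp (-α * T ^ 2) / (2 * α * T ^ 2) := by positivity
  have hy : 0 ≤ Real.exp (-(1 / (4 * α)) * ΔE ^ 2) +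
      √(1 / (Real.pi * α)) * Metric.diam (sector n : Set ℝ) := by positivity
  refine norm_expectation_le_of_sum_le sector n e he ?_ (key.trans
    (mul_le_mul_of_nonneg_left (clustering_bound_le hn hu hy) (Nat.cast_nonneg _)))
  exact mul_nonneg hM (add_nonneg (mul_nonneg (by positivity)
    (add_nonneg (mul_nonneg hc hT') (mul_nonneg zero_le_two hu))) hy)

theorem Exhausts.eventually_subset {Γ : SimpleGraph V} (h : S.Exhausts Γ) (X : Finset V) :
    ∀ᶠ n in atTop, X ⊆ S.sites n := by
  have : ∀ᶠ n in atTop, ∀ x ∈ X, x ∈ S.sites n :=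
    (Finset.eventually_all X).2 fun x _ => h.eventually_mem x
  exact this

theorem Exhausts.eventually_setDist_eq {Γ : SimpleGraph V} (h : S.Exhausts Γ) (X Y : Finset V) :
    ∀ᶠ n in atTop, setDist (S.graph n) X Y = setDist Γ X Y := by
  have : ∀ᶠ n in atTop, ∀ x ∈ X, ∀ y ∈ Y, (S.graph n).dist x y = Γ.dist x y :=
    (Finset.eventually_all X).2 fun x _ => (Finset.eventually_all Y).2 fun y _ =>
      h.eventually_dist x y
  filter_upwards [this] with n hn
  unfold setDist
  congr 1
  ext r
  constructor
  · rintro ⟨x, hx, y, hy, rfl⟩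
    exact ⟨x, hx, y, hy, hn x hx y hy⟩
  · rintro ⟨x, hx, y, hy, rfl⟩
    exact ⟨x, hx, y, hy, (hn x hx y hy).symm⟩

/-- Collects the three errors once they have the common size `ε`. The prefactor `1 / θ` of the
Gaussian tail is harmless because it is bounded by the constant `q`. -/
theorem exponential_prefactor_le {N F x ε θ q : ℝ} (hN : 1 ≤ N) (hε : 0 < ε) (hF : F * x ≤ ε)
    (hθ : 0 < θ) (hq : 1 / θ ≤ q) :
    1 / Real.pi * (2 * (N * F) * x + 2 * (ε / (2 * θ))) + ε ≤ (2 + q) * N * ε := by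
  have hpi : 1 / Real.pi ≤ 1 / 2 := one_div_le_one_div_of_le two_pos Real.two_le_pi
  have hinv : 0 < 1 / θ := by positivity
  have h1 : ε ≤ N * ε := le_mul_of_one_le_left hε.le hN
  have h2 : N * (F * x) ≤ N * ε := mul_le_mul_of_nonneg_left hF (by linarith)
  have h3 : ε * (1 / θ) ≤ N * ε * q := mul_le_mul h1 hq hinv.le (by positivity)
  have h4 : 0 ≤ ε * (1 / θ) := by positivity
  calc 1 / Real.pi * (2 * (N * F) * x + 2 * (ε / (2 * θ))) + ε
      = 1 / Real.pi * (2 * (N * (F * x)) + ε * (1 / θ)) + ε := by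
        congr 2
        field_simp
    _ ≤ 1 / Real.pi * (2 * (N * ε) + N * ε * q) + N * ε := by gcongr
    _ ≤ 1 / 2 * (2 * (N * ε) + N * ε * q) + N * ε :=
        add_le_add_left (mul_le_mul_of_nonneg_right hpi (by linarith)) _
    _ ≤ _ := by linarith

/-- Decay of the fermionic ground-state correlations, for interactions that propagate like
`exp (-G r)` with velocity `v`. -/
theorem PropagatesAs.fermionicDecay {f f' G : ℝ → ℝ} {v ΔE : ℝ} (h : S.PropagatesAs f v)
    (hv : 0 < v) (hΔ : 0 < ΔE) (hG : MonotoneOn G (Set.Ici 0)) (hG0 : G 0 = 0) (hG1 : 0 < G 1)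
    (hf : ∀ r, 0 ≤ r → f r = Real.exp (-G r))
    (hf' : ∀ r, 0 ≤ r → f' r = Real.exp (-(G r / (1 + 2 * v / ΔE))))
    {Γ : SimpleGraph V} {sector : ℕ → Finset ℝ} {Q : Submodule ℂ (Op k d)} {ω : Q →ₗ[ℂ] ℂ}
    (hex : S.Exhausts Γ) (hgap : S.HasUniformGap sector ΔE)
    (hω : S.IsGroundStateExpectation sector Q ω) :
    FermionicDecay Γ Q ω f' (2 + (1 + 2 * v / ΔE) / G 1) := by
  intro X Y A hA B hB hpair hAB
  obtain ⟨-, φ, hφ, hlim⟩ := hω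
  have hlim := (hlim ⟨A * B, hAB⟩).norm
  have hden : 0 < 1 + 2 * v / ΔE := by positivity
  have hanti : AntitoneOn f (Set.Ici 0) := fun r hr s hs hrs => by
    rw [hf r hr, hf s hs]
    exact Real.exp_le_exp.2 (neg_le_neg (hG hr hs hrs))
  -- For an empty support the right-hand side is zero. One of the observables is then a scalar, so
  -- the pair commutes as well as anticommutes and its product vanishes.
  by_cases hcard : X = ∅ ∨ Y = ∅
  · have hz : A * B = 0 := by
      have hd : Disjoint X Y := by rcases hcard with rfl | rfl <;> simp
      have hc : A * B = B * A := by
        rcases hcard with rfl | rfl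
        · exact commute_of_mem_localAlgebra_empty hA B
        · exact (commute_of_mem_localAlgebra_empty hB A).symm
      have h1 := hpair hd
      rw [← hc, ← two_smul ℂ] at h1
      exact (smul_eq_zero.1 h1).resolve_left two_ne_zero
    have h0 : (⟨A * B, hAB⟩ : Q) = 0 := Subtype.ext hz
    rw [h0, map_zero, norm_zero]
    rcases hcard with rfl | rfl <;> simp
  rw [not_or] at hcard
  have hXc : (1 : ℝ) ≤ X.card := by
    exact_mod_cast Finset.one_le_card.2 (Finset.nonempty_iff_ne_empty.2 hcard.1)
  have hYc : (1 : ℝ) ≤ Y.card := by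
    exact_mod_cast Finset.one_le_card.2 (Finset.nonempty_iff_ne_empty.2 hcard.2)
  have hXY : (1 : ℝ) ≤ X.card * Y.card := one_le_mul_of_one_le_of_one_le hXc hYc
  have hsub : ∀ᶠ j in atTop, X ⊆ S.sites (φ j) ∧ Y ⊆ S.sites (φ j) ∧
      setDist (S.graph (φ j)) X Y = setDist Γ X Y :=
    hφ.tendsto_atTop.eventually
      ((hex.eventually_subset X).and ((hex.eventually_subset Y).and (hex.eventually_setDist_eq X Y)))
  rw [hf' _ (Nat.cast_nonneg _)]
  -- At distance zero anticommutation need not be available, but the decay factor is `1` and the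
  -- trivial bound suffices.
  rcases Nat.eq_zero_or_pos (setDist Γ X Y) with hr | hr
  · rw [hr, Nat.cast_zero, hG0, zero_div, neg_zero, Real.exp_zero, mul_one]
    have h1 : ‖ω ⟨A * B, hAB⟩‖ ≤ ‖A * B‖ := by
      refine le_of_tendsto hlim (hsub.mono fun j hj => ?_)
      exact norm_expectation_le sector _
        ((commute_starProjection_of_mem_localAlgebra hj.1 hA).mul_right
          (commute_starProjection_of_mem_localAlgebra hj.2.1 hB))
    have h2 : 1 ≤ 2 + (1 + 2 * v / ΔE) / G 1 := by
      have := div_pos hden hG1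
      linarith
    calc ‖ω ⟨A * B, hAB⟩‖ ≤ ‖A‖ * ‖B‖ := h1.trans (norm_mul_le A B)
      _ ≤ (2 + (1 + 2 * v / ΔE) / G 1) * (X.card * Y.card) * (‖A‖ * ‖B‖) :=
        le_mul_of_one_le_left (by positivity) (one_le_mul_of_one_le_of_one_le h2 hXY)
      _ = _ := by ring
  · set r : ℝ := (setDist Γ X Y : ℝ) with hrdef
    have hr1 : (1 : ℝ) ≤ r := Nat.one_le_cast.2 hr
    have hGr : G 1 ≤ G r := hG (Set.mem_Ici.2 zero_le_one) (Set.mem_Ici.2 (zero_le_one.trans hr1)) hr1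
    have hGpos : 0 < G r := hG1.trans_le hGr
    -- This `T` solves `G r - v * T = ΔE * T / 2`, balancing the light-cone error against the
    -- Gaussian errors.
    set T := G r / (v + ΔE / 2) with hTdef
    have hT : 0 < T := by positivity
    set Θ := G r / (1 + 2 * v / ΔE) with hΘdef
    have hΘ : Θ = ΔE * T / 2 := by
      rw [hΘdef, hTdef]
      field_simp
      ring
    have hGT : G r = v * T + Θ := by
      rw [hΘ, hTdef]
      field_simp
    have hΘpos : 0 < Θ := by rw [hΘ]; positivity
    set α := ΔE / (2 * T) with hαdef
    have hα : 0 < α := by positivity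
    have e1 : -α * T ^ 2 = -Θ := by rw [hαdef, hΘ]; field_simp
    have e2 : 2 * α * T ^ 2 = 2 * Θ := by rw [hαdef, hΘ]; field_simp
    have e3 : -(1 / (4 * α)) * ΔE ^ 2 = -Θ := by rw [hαdef, hΘ]; field_simp; ring
    have hd := disjoint_of_setDist_pos hr
    -- The final factor `0` is the limit of the width of the sector. The time `T` and the parameter
    -- `α` depend only on the distance in `Γ`, so they stay fixed in the limit.
    have hbound : ‖ω ⟨A * B, hAB⟩‖ ≤ ‖A‖ * ‖B‖ *
        (1 / Real.pi * (2 * (X.card * Y.card * f r) * (Real.exp (v * T) - 1) +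
          2 * (Real.exp (-α * T ^ 2) / (2 * α * T ^ 2))) +
          (Real.exp (-(1 / (4 * α)) * ΔE ^ 2) + √(1 / (Real.pi * α)) * 0)) := by
      refine le_of_tendsto_of_tendsto hlim
        ((((hgap.width.comp hφ.tendsto_atTop).const_mul _).const_add _).const_add _ |>.const_mul _)
        (hsub.mono fun j hj => ?_)
      have := norm_expectation_mul_le h hanti
        (fun s hs => by rw [hf s hs]; exact (Real.exp_pos _).le) hv hΔ hgap hj.1 hj.2.1 hA hB
        (hpair hd) hα hT
      rw [hj.2.2] at this
      exact this
    rw [e1, e2, e3, mul_zero, add_zero] at hbound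
    have hfe : f r * (Real.exp (v * T) - 1) ≤ Real.exp (-Θ) := by
      rw [hf r (zero_le_one.trans hr1), mul_sub, mul_one, ← Real.exp_add,
        show -G r + v * T = -Θ by rw [hGT]; ring]
      linarith [Real.exp_pos (-G r)]
    -- A positive distance is an integer, hence at least `1`, and `G r ≥ G 1`.
    have hΘ1 : 1 / Θ ≤ (1 + 2 * v / ΔE) / G 1 := by
      rw [hΘdef, one_div_div]
      gcongr
    refine hbound.trans ((mul_le_mul_of_nonneg_left (exponential_prefactor_le hXY
      (Real.exp_pos (-Θ)) hfe hΘpos hΘ1) (by positivity)).trans_eq ?_)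
    ring

end LatticeSystem

end LatticeQuantum

end

/-! ### The power-law and exponential cases -/

theorem mainTheorem4 :
    (∃ v : ℝ → LatticeQuantum.PowerConstants → ℝ,
      (∀ κ, MonotoneOn (fun η => v η κ) (Set.Ioi 0)) ∧
      (∀ η κ, 0 < v η κ) ∧
      (∀ η : ℝ, 0 < η → ∀ κ : LatticeQuantum.PowerConstants, ∃ C : ℝ, 0 < C ∧
        ∀ (V : Type u) [LinearOrder V] (k d : V → ℕ) (S : LatticeQuantum.LatticeSystem k d),
          S.PowerLaw η κ →
            S.IsGroupVelocityBound (fun r => (1 + r) ^ (-η)) C (v η κ)) ∧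
      (∀ η : ℝ, 0 < η → ∀ κ : LatticeQuantum.PowerConstants, ∀ ΔE : ℝ, 0 < ΔE →
        ∃ C : ℝ, 0 < C ∧
          ∀ (V : Type u) [LinearOrder V] (k d : V → ℕ) (S : LatticeQuantum.LatticeSystem k d)
            (Γ : SimpleGraph V) (sector : ℕ → Finset ℝ)
            (Q : Submodule ℂ (LatticeQuantum.Op k d)) (ω : Q →ₗ[ℂ] ℂ),
            S.PowerLaw η κ → S.Exhausts Γ → S.HasUniformGap sector ΔE →
            S.IsGroundStateExpectation sector Q ω →
              LatticeQuantum.LatticeSystem.FermionicDecay Γ Q ω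
                (fun r => (1 + r) ^ (-(η / (1 + 2 * v η κ / ΔE)))) C)) ∧
    (∃ v : ℝ → LatticeQuantum.ExpConstants → ℝ,
      (∀ κ, MonotoneOn (fun μ => v μ κ) (Set.Ioi 0)) ∧
      (∀ μ κ, 0 < v μ κ) ∧
      (∀ μ : ℝ, 0 < μ → ∀ κ : LatticeQuantum.ExpConstants, ∃ C : ℝ, 0 < C ∧
        ∀ (V : Type u) [LinearOrder V] (k d : V → ℕ) (S : LatticeQuantum.LatticeSystem k d),
          S.ExpDecay μ κ →
            S.IsGroupVelocityBound (fun r => Real.exp (-(μ * r))) C (v μ κ)) ∧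
      (∀ μ : ℝ, 0 < μ → ∀ κ : LatticeQuantum.ExpConstants, ∀ ΔE : ℝ, 0 < ΔE →
        ∃ C : ℝ, 0 < C ∧
          ∀ (V : Type u) [LinearOrder V] (k d : V → ℕ) (S : LatticeQuantum.LatticeSystem k d)
            (Γ : SimpleGraph V) (sector : ℕ → Finset ℝ)
            (Q : Submodule ℂ (LatticeQuantum.Op k d)) (ω : Q →ₗ[ℂ] ℂ),
            S.ExpDecay μ κ → S.Exhausts Γ → S.HasUniformGap sector ΔE →
            S.IsGroundStateExpectation sector Q ω →
              LatticeQuantum.LatticeSystem.FermionicDecay Γ Q ω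
                (fun r => Real.exp (-(μ / (1 + 2 * v μ κ / ΔE) * r))) C)) := by
  -- The velocities depend on the constants of the conditions only, not on `η` or `μ`, so they are
  -- trivially monotone. The denominators `η * Real.log (1 + 1)` and `μ * 1` are the values `G 1`
  -- for `G r = η * Real.log (1 + r)` and `G r = μ * r`.
  refine ⟨⟨fun _ κ => LatticeQuantum.powerVelocity κ, fun κ => monotoneOn_const, fun _ κ => LatticeQuantum.powerVelocity_pos κ,
    fun η hη κ => ⟨2, two_pos, fun V _ k d S hS => ?_⟩, fun η hη κ ΔE hΔ =>
      ⟨2 + (1 + 2 * LatticeQuantum.powerVelocity κ / ΔE) / (η * Real.log (1 + 1)), ?_,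
        fun V _ k d S Γ sector Q ω hS hex hgap hω => ?_⟩⟩,
    ⟨fun _ κ => LatticeQuantum.expVelocity κ, fun κ => monotoneOn_const, fun _ κ => LatticeQuantum.expVelocity_pos κ,
    fun μ hμ κ => ⟨2, two_pos, fun V _ k d S hS => ?_⟩, fun μ hμ κ ΔE hΔ =>
      ⟨2 + (1 + 2 * LatticeQuantum.expVelocity κ / ΔE) / (μ * 1), ?_,
        fun V _ k d S Γ sector Q ω hS hex hgap hω => ?_⟩⟩⟩
  · exact (hS.propagatesAs hη).isGroupVelocityBound (LatticeQuantum.antitoneOn_one_add_rpow_neg hη.le)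
      (LatticeQuantum.powerVelocity_pos κ)
  · have := LatticeQuantum.powerVelocity_pos κ
    have : 0 < Real.log (1 + 1) := Real.log_pos (by norm_num)
    positivity
  · refine (hS.propagatesAs hη).fermionicDecay (G := fun r => η * Real.log (1 + r))
      (LatticeQuantum.powerVelocity_pos κ) hΔ (fun r hr s _ hrs => ?_) (by simp)
      (mul_pos hη (Real.log_pos (by norm_num))) (fun r hr => ?_) (fun r hr => ?_) hex hgap hω
    · have hr : 0 ≤ r := hr
      exact mul_le_mul_of_nonneg_left (Real.log_le_log (by linarith) (by linarith)) hη.le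
    · rw [Real.rpow_def_of_pos (by linarith)]
      congr 1
      ring
    · rw [Real.rpow_def_of_pos (by linarith)]
      congr 1
      ring
  · exact (hS.propagatesAs hμ).isGroupVelocityBound (LatticeQuantum.antitoneOn_exp_neg_mul hμ.le)
      (LatticeQuantum.expVelocity_pos κ)
  · have := LatticeQuantum.expVelocity_pos κ
    positivity
  · refine (hS.propagatesAs hμ).fermionicDecay (G := fun r => μ * r)
      (LatticeQuantum.expVelocity_pos κ) hΔ (fun r _ s _ hrs => mul_le_mul_of_nonneg_left hrs hμ.le) (by simp)
      (by simpa using hμ) (fun r hr => rfl) (fun r hr => ?_) hex hgap hω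
    congr 1
    ring
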